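/- Notation. $\oplus$ is XOR and $\Vert$ is concatenation. There are $m\ge 1$ parties $P_1,\dots,P_m$ with leader $P_1$; party $P_j$ holds a set $X_j=\{x_j^1,\dots,x_j^n\}\subseteq\{0,1\}^l$ of $n$ distinct elements. Public functions are an arbitrary $H:\{0,1\}^l\to\{0,1\}^\kappa$, arbitrary $h_1,h_2,h_3:\{0,1\}^l\to[B]$, and an arbitrary placement (eviction) procedure, using $\rho$ random bits, which places the elements of a set into $B$ bins. Its result is a Cuckoo table if every stored element $x\Vert k$ lies in bin $h_k(x)$ and every element of the set is stored in exactly one bin; otherwise Cuckoo hashing fails. Functionalities. * $F_{\mathrm{bssPMT}}$: the sender inputs sets $T^1,\dots,T^B$, the receiver inputs queries $c^1,\dots,c^B$ (a dummy query, for an empty bin, is in no set); for each $b$ they get random bits $e_S^b,e_R^b$ with $e_S^b\oplus e_R^b=1$ if $c^b\in T^b$ and $=0$ otherwise. * $F_{\mathrm{mssROT}}$: among parties of which two input choice bits $b_0,b_1$ and those in a set $J$ input strings $\Delta_j$; the parties get uniform strings whose XOR is $0$ if $b_0\oplus b_1=0$ and $\bigoplus_{j\in J}\Delta_j$ otherwise.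 * $F_{\mathrm{MS}}$: each party inputs a vector; for a uniformly random permutation $\pi$ the parties get a uniform XOR-sharing of $\pi$ applied to the XOR of the inputs. * $F_{\mathrm{MPSU}}$: $P_1$ gets $\bigcup_{i=1}^m X_i$, the other parties get nothing. Protocol SK-MPSU. 1. $P_j$ ($j\ge 2$) computes a Cuckoo table $C_j^1,\dots,C_j^B$ of $X_j$ by the placement procedure with fresh coins, and every $P_i$ computes the simple table $T_i^b=\{x\Vert k: x\in X_i,\ k\in\{1,2,3\},\ h_k(x)=b\}$. 2. For $i<j$, $P_i$ (as sender, with $T_i^1,\dots,T_i^B$) and $P_j$ (as receiver, with $C_j^1,\dots,C_j^B$) call $F_{\mathrm{bssPMT}}$ and get bits $e_{i,j}^b$ and $e_{j,i}^b$. 3. For $i<j$ and $b\in[B]$, the parties $P_{\min(2,i)},\dots,P_j$ call $F_{\mathrm{mssROT}}$ with strings of length $l+\kappa$, with choice bits $e_{i,j}^b$ of $P_i$ and $e_{j,i}^b$ of $P_j$, and with a fresh uniform $\Delta$ from each of $P_2,\dots,P_j$; $P_d$ gets $r_{d,ji}^b$. For $d<j$, $P_d$ sets $u_{d,j}^b$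 to the XOR of its $r_{d,ji}^b$ over $i<j$. $P_j$ sets $u_{j,j}^b=\bigoplus_{i<j}r_{j,ji}^b\oplus(x\Vert H(x))$ if $C_j^b$ contains the element $x$, and chooses $u_{j,j}^b$ uniformly if $C_j^b$ is empty. 4. All parties call $F_{\mathrm{MS}}$ on the vectors of length $(m-1)B$ of their $u_{d,j}^b$ ($2\le j\le m$, $b\in[B]$; with $0$ where $d>j$), and get shares. 5. All parties send these shares to $P_1$, who reconstructs the vector $v$ by XOR and outputs $X_1\cup\{x\in\{0,1\}^l:\ v_p=x\Vert H(x)\text{ for some position }p\}$. Theorem. The SK-MPSU protocol securely realizes $F_{\mathrm{MPSU}}$ against any semi-honest adversary corrupting a set of $t<m$ parties (no non-collusion assumption) in the $(F_{\mathrm{bssPMT}},F_{\mathrm{mssROT}},F_{\mathrm{MS}})$-hybrid model. Precisely: there is a fixed polynomial such that for all $m\ge 1$, $n,l,\kappa,B,\rho$ and every set $\mathcal C$ of fewer than $m$ parties there is a simulator, a probabilistic circuit (with gates for NAND, for uniform choices among $k$ outcomes at cost $k$, and for evaluating $H$, $h_k$ and the placement procedure at unit cost) whose size is bounded by the polynomial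 in $m+n+l+\kappa+B+\rho+1$, such that the following holds for all public functions and all inputs. The simulator receives the inputs of the parties in $\mathcal C$ and, if $P_1\in\mathcal C$, also the union $\bigcup_i X_i$ (listed in an order that depends on the union only). The joint distribution of the views (input, random tape, outputs of the functionalities, received messages) of all parties in $\mathcal C$ and the output of $P_1$ in a real execution is within statistical distance $$\frac{(m-1)B}{2^{\kappa}}+\Pr[\text{Cuckoo hashing fails for some } P_j,\ j\ge 2]$$ of the joint distribution of the simulator's output and $\bigcup_{i=1}^m X_i$. (In particular, if $\kappa\ge\sigma+\log_2((m-1)B)$ the first term is at most $2^{-\sigma}$.) -/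

import Mathlib

/-! Bits are elements of `ZMod 2`, so that `+` is XOR and `∑` is the XOR of a family.
Parties are `Fin m`; party `0` is the leader (the first party). -/

/-- A bit. -/
abbrev Bit : Type := ZMod 2

/-- Bit strings of length `k`. -/
abbrev Str (k : ℕ) : Type := Fin k → Bit

/-- The numerical parameters: number `m` of parties, set size `n`, element length `l`, hash length
`κ`, number `B` of bins, and number `ρ` of coins that one Cuckoo hashing consumes. -/
structure Sizes where
  m : ℕ
  n : ℕ
  l : ℕ
  κ : ℕ
  B : ℕ
  ρ : ℕ

namespace Sizes

/-- The sum of all numerical parameters, plus one. -/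
def total (s : Sizes) : ℕ := s.m + s.n + s.l + s.κ + s.B + s.ρ + 1

/-- A party. -/
abbrev Party (s : Sizes) : Type := Fin s.m

/-- A bin. -/
abbrev Bin (s : Sizes) : Type := Fin s.B

/-- A set element, a string of length `l`. -/
abbrev Elem (s : Sizes) : Type := Str s.l

/-- A share, a string of length `l + κ`. -/
abbrev Block (s : Sizes) : Type := Str (s.l + s.κ)

/-- The input of a party: its elements `x ^ 1, …, x ^ n` (which will be required to be distinct). -/
abbrev Input (s : Sizes) : Type := Fin s.n → s.Elem

/-- What is stored in a bin: an element together with the index of a hash function. -/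
abbrev Item (s : Sizes) : Type := s.Elem × Fin 3

/-- The positions of the shared vector, one for each non-leader party and each bin. There are
`(m - 1) * B` of them. -/
abbrev Pos (s : Sizes) [NeZero s.m] : Type := {j : s.Party // j ≠ 0} × s.Bin

/-- The raw result of Cuckoo hashing: bin `b` is empty, or holds the element number `t` of the
input, put there by the hash function number `k`. -/
abbrev Table (s : Sizes) : Type := s.Bin → Option (Fin s.n × Fin 3)

end Sizes

/-- The public functions of the protocol: the hash function that is appended to elements, the
three bin-choosing hash functions, and an arbitrary randomized (eviction) procedure for Cuckoo
hashing, as a function of its coins and of the input. Nothing is assumed about them; whether the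
procedure produced a Cuckoo table is `IsCuckoo` below. -/
structure PublicFunctions (s : Sizes) where
  hash : s.Elem → Str s.κ
  bin : Fin 3 → s.Elem → s.Bin
  place : Str s.ρ → s.Input → s.Table

/-- `T` is a Cuckoo hash table of the elements `x`: each stored element lies in the bin that the
indicated hash function chooses for it, and each element is stored in exactly one bin. -/
def IsCuckoo {s : Sizes} (pp : PublicFunctions s) (x : s.Input) (T : s.Table) : Prop :=
  (∀ b t k, T b = some (t, k) → pp.bin k (x t) = b) ∧
    ∀ t, ∃! b, ∃ k, T b = some (t, k)

/-- Simple hashing: bin `b` holds all `(x, k)` with `x` in the set and `h_k(x) = b`. -/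
def simpleTable {s : Sizes} (pp : PublicFunctions s) (x : s.Input) (b : s.Bin) :
    Finset s.Item :=
  ((Finset.univ : Finset (Fin s.n × Fin 3)).image fun tk => (x tk.1, tk.2)).filter
    fun it => pp.bin it.2 it.1 = b

/-- The set of elements of an input. -/
def elems {s : Sizes} (x : s.Input) : Finset s.Elem := Finset.univ.image x

/-! ### Ideal functionalities

A functionality is written as a function of its inputs and of its own internal coins, which are
uniformly distributed in every execution. -/

/-- The multi-party private set union: the output of the leader. -/
def unionOf {s : Sizes} (X : s.Party → s.Input) : Finset s.Elem :=
  Finset.univ.biUnion fun j => elems (X j)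

/-- Batch secret-shared private membership test: the sender inputs sets, the receiver inputs
queries (`none` is the dummy query of an empty bin, which belongs to no set). The result is the
output of the sender and the output of the receiver: in each instance uniform bits
whose XOR tells whether the query is a member. -/
def bssPMT {s : Sizes} (coin : s.Bin → Bit) (sets : s.Bin → Finset s.Item)
    (query : s.Bin → Option s.Item) : (s.Bin → Bit) × (s.Bin → Bit) :=
  (coin, fun b => coin b + if ∃ it ∈ sets b, query b = some it then 1 else 0)

/-- Multi-party secret-shared random oblivious transfer among the parties in `Q`, with distinguished
party `first ∈ Q`, choice bits `b₀, b₁` and shares `Δ j`, `j ∈ J`. Parties outside `Q` are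
not involved (their output is `0` by convention). -/
def mssROT {s : Sizes} (coin : s.Party → s.Block) (Q : Finset s.Party) (first : s.Party)
    (J : Finset s.Party) (b₀ b₁ : Bit) (Δ : s.Party → s.Block) (d : s.Party) : s.Block :=
  if d = first then
    ∑ i ∈ Q.erase first, coin i + if b₀ + b₁ = 0 then 0 else ∑ j ∈ J, Δ j
  else if d ∈ Q then coin d else 0

/-- Multi-party secret-shared shuffle: with `π` uniform, the result is a uniform additive sharing of
the sum of the input vectors, permuted by `π`. -/
def shuffle {s : Sizes} [NeZero s.m] (π : Equiv.Perm s.Pos) (coin : s.Party → s.Pos → s.Block)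
    (x : s.Party → s.Pos → s.Block) (i : s.Party) (p : s.Pos) : s.Block :=
  if i = 0 then ∑ k, x k (π p) + ∑ k ∈ Finset.univ.erase 0, coin k p else coin i p

/-! ### The protocol in the hybrid model -/

/-- All the randomness of an execution: the random tapes of the parties (first three fields) and
the coins of the ideal functionalities. Coins with indices that the protocol does not use are
never looked at. -/
structure Coins (s : Sizes) [NeZero s.m] where
  /-- coins of the Cuckoo hashing of each party -/
  cuckoo : s.Party → Str s.ρ
  /-- `delta d j i b` is the share of `Δ` of party `d` in the instance `(j, i, b)` of mss-ROT -/
  delta : s.Party → s.Party → s.Party → s.Bin → s.Block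
  /-- the random value that a party uses for an empty bin -/
  pad : s.Party → s.Bin → s.Block
  /-- `pmt i j` are the coins of the batch ssPMT with sender `i` and receiver `j` -/
  pmt : s.Party → s.Party → s.Bin → Bit
  /-- `rot j i b` are the coins of the instance `(j, i, b)` of mss-ROT -/
  rot : s.Party → s.Party → s.Bin → s.Party → s.Block
  /-- permutation of the shuffle -/
  perm : Equiv.Perm s.Pos
  /-- coins for the re-sharing of the shuffle -/
  share : s.Party → s.Pos → s.Block

set_option synthInstance.maxHeartbeats 400000 in
set_option synthInstance.maxSize 2000 in
noncomputable instance {s : Sizes} [NeZero s.m] : Fintype (Coins s) :=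
  Fintype.ofInjective
    (fun ω : Coins s => (ω.cuckoo, ω.delta, ω.pad, ω.pmt, ω.rot, ω.perm, ω.share)) fun ω ω' h => by
      cases ω; cases ω'; simpa using h

instance {s : Sizes} [NeZero s.m] : Nonempty (Coins s) :=
  ⟨⟨0, 0, 0, 0, 0, 1, 0⟩⟩

section Protocol

variable {s : Sizes} [NeZero s.m] (pp : PublicFunctions s) (X : s.Party → s.Input) (ω : Coins s)

/-- Step 1: the Cuckoo hash table of party `j`, with elements in place of their numbers. -/
def cuckooTable (j : s.Party) (b : s.Bin) : Option s.Item :=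
  (pp.place (ω.cuckoo j) (X j) b).map fun tk => (X j tk.1, tk.2)

/-- Step 2: `pmtOut c k b` is the bit that party `c` gets in instance `b` of the batch ssPMT between
`c` and `k`. The party with the smaller number is the sender. -/
def pmtOut (c k : s.Party) (b : s.Bin) : Bit :=
  if c < k then (bssPMT (ω.pmt c k) (simpleTable pp (X c)) (cuckooTable pp X ω k)).1 b
  else if k < c then (bssPMT (ω.pmt k c) (simpleTable pp (X k)) (cuckooTable pp X ω c)).2 b
  else 0

/-- Step 3: `rotOut d j i b` is the output of party `d` in the mss-ROT for `i < j` and bin `b`. The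
involved parties are those from `min 1 i` to `j` (counting from `0`), the choice bits come from `i`
and `j`, and all non-leader parties up to `j` supply shares of `Δ`. -/
def rotOut (d j i : s.Party) (b : s.Bin) : s.Block :=
  if i < j then
    mssROT (ω.rot j i b) (Finset.Icc (min 1 i) j) (min 1 i)
      (Finset.univ.filter fun d' => d' ≠ 0 ∧ d' ≤ j)
      (pmtOut pp X ω i j b) (pmtOut pp X ω j i b) (fun d' => ω.delta d' j i b) d
  else 0

/-- An element with its hash value appended. -/
def encodeElem (x : s.Elem) : s.Block := Fin.append x (pp.hash x)

/-- Step 3, continued: the share `u d j b` of party `d` for bin `b` of party `j`. -/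
def shareOut (d j : s.Party) (b : s.Bin) : s.Block :=
  if d < j then ∑ i ∈ Finset.univ.filter (· < j), rotOut pp X ω d j i b
  else if d = j then
    match cuckooTable pp X ω j b with
    | some it => ∑ i ∈ Finset.univ.filter (· < j), rotOut pp X ω j j i b + encodeElem pp it.1
    | none => ω.pad j b
  else 0

/-- Step 4: the output of party `i` from the shuffle. -/
def shuffleOut (i : s.Party) (p : s.Pos) : s.Block :=
  shuffle ω.perm ω.share (fun d q => shareOut pp X ω d q.1 q.2) i p

/-- Step 5: all parties send their shuffled shares to the leader, who reconstructs the vector, and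
outputs its own set together with all `x` for which `x ‖ hash x` is an entry. -/
def leaderOut : Finset s.Elem :=
  elems (X 0) ∪ Finset.univ.filter fun x =>
    ∃ p : s.Pos, ∑ i, shuffleOut pp X ω i p = encodeElem pp x

end Protocol

/-! ### Views -/

/-- The names of the bits in the view of a party: its input, its random tape (three kinds), its
outputs from the three functionalities, and the messages it receives from the other parties. -/
inductive ViewWire (s : Sizes) [NeZero s.m] : Type
  | input (t : Fin s.n) (a : Fin s.l)
  | cuckoo (a : Fin s.ρ)
  | delta (j i : s.Party) (b : s.Bin) (a : Fin (s.l + s.κ))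
  | pad (b : s.Bin) (a : Fin (s.l + s.κ))
  | pmt (k : s.Party) (b : s.Bin)
  | rot (j i : s.Party) (b : s.Bin) (a : Fin (s.l + s.κ))
  | shuffled (p : s.Pos) (a : Fin (s.l + s.κ))
  | message (k : s.Party) (p : s.Pos) (a : Fin (s.l + s.κ))

/-- The view of party `c` in an execution. Only the leader receives messages. -/
def view {s : Sizes} [NeZero s.m] (pp : PublicFunctions s) (X : s.Party → s.Input) (ω : Coins s)
    (c : s.Party) : ViewWire s → Bit
  | .input t a => X c t a
  | .cuckoo a => ω.cuckoo c a
  | .delta j i b a => ω.delta c j i b a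
  | .pad b a => ω.pad c b a
  | .pmt k b => pmtOut pp X ω c k b
  | .rot j i b a => rotOut pp X ω c j i b a
  | .shuffled p a => shuffleOut pp X ω c p a
  | .message k p a => if c = 0 then shuffleOut pp X ω k p a else 0

/-! ### Simulators: probabilistic circuits with a size -/

/-- Probabilistic circuits from input wires `ι` to output wires `ο`. Gates: constant `1`, NAND,
a uniform choice among `k + 1` outcomes (given in one-hot form), and evaluation of
the public functions of the protocol. Circuits are composed in sequence and in parallel; wires may
be permuted, duplicated and dropped. -/
inductive Circuit (s : Sizes) : Type → Type → Type 1
  | wire {ι ο : Type} (f : ο → ι) : Circuit s ι ο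
  | one : Circuit s Empty Unit
  | nand : Circuit s (Fin 2) Unit
  | pick (k : ℕ) : Circuit s Empty (Fin (k + 1))
  | hash : Circuit s (Fin s.l) (Fin s.κ)
  | bin (k : Fin 3) : Circuit s (Fin s.l) s.Bin
  | place : Circuit s (Fin s.ρ ⊕ Fin s.n × Fin s.l) (s.Bin × Fin s.n × Fin 3)
  | comp {ι ο τ : Type} (c : Circuit s ι ο) (d : Circuit s ο τ) : Circuit s ι τ
  | par {ι ο ι' ο' : Type} (c : Circuit s ι ο) (d : Circuit s ι' ο') :
      Circuit s (ι ⊕ ι') (ο ⊕ ο')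

namespace Circuit

/-- The size: each gate counts one, a choice among `k + 1` outcomes counts `k + 1`. -/
def size {s : Sizes} : {ι ο : Type} → Circuit s ι ο → ℕ
  | _, _, wire _ => 0
  | _, _, one => 1
  | _, _, nand => 1
  | _, _, pick k => k + 1
  | _, _, hash => 1
  | _, _, bin _ => 1
  | _, _, place => 1
  | _, _, comp c d => c.size + d.size
  | _, _, par c d => c.size + d.size

/-- The distribution of the output bits of a circuit for given input bits. -/
noncomputable def eval {s : Sizes} (pp : PublicFunctions s) :
    {ι ο : Type} → Circuit s ι ο → (ι → Bit) → PMF (ο → Bit)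
  | _, _, wire f, x => PMF.pure (x ∘ f)
  | _, _, one, _ => PMF.pure fun _ => 1
  | _, _, nand, x => PMF.pure fun _ => 1 + x 0 * x 1
  | _, _, pick k, _ => (PMF.uniformOfFintype (Fin (k + 1))).map fun i j => if j = i then 1 else 0
  | _, _, hash, x => PMF.pure (pp.hash x)
  | _, _, bin k, x => PMF.pure fun b => if pp.bin k x = b then 1 else 0
  | _, _, place, x => PMF.pure fun btk =>
      if pp.place (fun a => x (.inl a)) (fun t a => x (.inr (t, a))) btk.1 = some btk.2
      then 1 else 0
  | _, _, comp c d, x => (c.eval pp x).bind fun y => d.eval pp y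
  | _, _, par c d, x =>
      (c.eval pp (x ∘ Sum.inl)).bind fun y => (d.eval pp (x ∘ Sum.inr)).map fun z => Sum.elim y z

end Circuit

/-- The input wires of a simulator for the corrupted set `C`: the inputs of the corrupted parties,
and a list of at most `m * n` elements (for each slot, a bit telling whether it is used, and the
element in it). -/
inductive SimWire (s : Sizes) (C : Finset s.Party) : Type
  | input (c : C) (t : Fin s.n) (a : Fin s.l)
  | used (q : Fin (s.m * s.n))
  | slot (q : Fin (s.m * s.n)) (a : Fin s.l)

/-- The bits of the inputs of the corrupted parties and of a set `U`, listed in an order that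
depends on `U` only. -/
noncomputable def simInput {s : Sizes} {C : Finset s.Party} (XC : C → s.Input)
    (U : Finset s.Elem) : SimWire s C → Bit
  | .input c t a => XC c t a
  | .used q => if q.val < U.toList.length then 1 else 0
  | .slot q a => U.toList.getD q.val 0 a

/-- A simulator for the corrupted set `C`; it outputs the views of all parties in `C`. -/
abbrev Simulator (s : Sizes) [NeZero s.m] (C : Finset s.Party) : Type 1 :=
  Circuit s (SimWire s C) (C × ViewWire s)

/-! ### Security -/

/-- The joint distribution of the views of the corrupted parties and the output of the protocol (the
leader's; the other parties have none) in a real execution in the hybrid model. -/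
noncomputable def realExec {s : Sizes} [NeZero s.m] (pp : PublicFunctions s) (C : Finset s.Party)
    (X : s.Party → s.Input) : PMF ((C × ViewWire s → Bit) × Finset s.Elem) :=
  (PMF.uniformOfFintype (Coins s)).map fun ω =>
    (fun cw => view pp X ω cw.1 cw.2, leaderOut pp X ω)

/-- The joint distribution of the simulated views and the output of the ideal functionality. The
simulator is given the inputs of the corrupted parties, and the union if the leader is corrupted. -/
noncomputable def idealExec {s : Sizes} [NeZero s.m] (pp : PublicFunctions s) {C : Finset s.Party}
    (S : Simulator s C) (X : s.Party → s.Input) :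
    PMF ((C × ViewWire s → Bit) × Finset s.Elem) :=
  (S.eval pp (simInput (fun c : C => X c) (if 0 ∈ C then unionOf X else ∅))).map
    fun v => (v, unionOf X)

/-- `p` and `q` have statistical distance at most `ε`: no event distinguishes them by more. -/
def StatClose {α : Type*} (ε : ℝ) (p q : PMF α) : Prop :=
  ∀ A : Set α, |(p.toOuterMeasure A).toReal - (q.toOuterMeasure A).toReal| ≤ ε

/-- The probability that Cuckoo hashing fails for some non-leader party. -/
noncomputable def cuckooFailure {s : Sizes} [NeZero s.m] (pp : PublicFunctions s)
    (X : s.Party → s.Input) : ℝ :=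
  ((PMF.uniformOfFintype (Coins s)).toOuterMeasure
    {ω | ∃ j : s.Party, j ≠ 0 ∧ ¬ IsCuckoo pp (X j) (pp.place (ω.cuckoo j) (X j))}).toReal

/-! The simulator runs the protocol on coins of its own, with everything that it cannot know left
out: a membership test with an honest sender counts as negative, and an mss-ROT adds its mask only
if all the parties involved are corrupted. If the leader is corrupted, the simulator also needs
the vector that the parties share. Let `p` be the first honest party. For bin `b` of party `j` the
shared value is `sharedValue` (`sum_shareOut`): an element with its hash value, plus a mask if an
earlier party has the element too, or a random string if the bin is empty. The simulator can
compute this value from the simulated views if `j < p`, or if `j` is corrupted and the bin is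
empty. Every other value is either uniform given the views of the corrupted parties, or the
encoding of an element that no earlier party has; when Cuckoo hashing succeeds, the latter are
exactly the encodings of the elements of the union that do not belong to a party before `p`, each
occurring once (`map_content_not_masked`). So the simulator knows the multiset of the entries that
are not uniform, and their positions do not matter because the shuffle permutes the vector. It
lists them, fills up with random strings, and permutes.

The comparison is exact, by two injections of the space of coins into itself, neither of which
touches the coins of Cuckoo hashing. `hybridCoins` moves what depends on honest inputs into coins
of honest parties, so that the real view depends on honest inputs only through the entries of the
vector that are not uniform (`view_eq_viewWith`);
`simCoins` absorbs the rearrangement of the vector into the permutation of the shuffle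
(`viewWith_simCoins`). Hence real and ideal execution can only differ if Cuckoo hashing fails or
if the leader's output is not the union. The latter requires that one of the `(m - 1) * B` values
is masked or from an empty bin, thus uniform, and is nevertheless of the form `x ‖ hash x`, which
has probability at most `2 ^ (-κ)` for each of them (`card_falsePositive_mul_le`, by shifting a
coin of the mask).

The size of the simulator is bounded with a small calculus: `BitComp` and `PropComp` say that a
bit or a truth value is computed by a circuit of size at most `s.total ^ k`, and are closed under
arithmetic, finite quantifiers, case distinctions and calls of the public functions. Because of
`2 ≤ s.total`, constant factors are absorbed by the exponent. The list of known entries is collected by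
a shift register (`realizes_registerBits`), and the matrix of a uniform permutation is sampled by
induction on its size (`samples_permBits`). -/

/-! ### Deterministic circuits relative to an encoding -/

/-- A circuit of size at most `M` turns the bits `enc d` of each datum `d` into the bits `f d`. The
circuit does not depend on `d`, in particular not on the public functions `pf d`. -/
def Realizes {s : Sizes} {D ι ο : Type} (pf : D → PublicFunctions s) (enc : D → ι → Bit) (M : ℕ)
    (f : D → ο → Bit) : Prop :=
  ∃ c : Circuit s ι ο, c.size ≤ M ∧ ∀ d, c.eval (pf d) (enc d) = PMF.pure (f d)

namespace Realizes

variable {s : Sizes} {D ι ο τ : Type} {pf : D → PublicFunctions s} {enc : D → ι → Bit} {M M' : ℕ}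

theorem mono {f : D → ο → Bit} (h : Realizes pf enc M f) (hM : M ≤ M') : Realizes pf enc M' f := by
  obtain ⟨c, hc, h⟩ := h
  exact ⟨c, hc.trans hM, h⟩

theorem wire (w : ο → ι) : Realizes pf enc 0 fun d => enc d ∘ w :=
  ⟨.wire w, le_rfl, fun _ => rfl⟩

theorem comp {f : D → ο → Bit} {g : D → τ → Bit} (hf : Realizes pf enc M f)
    (hg : Realizes pf f M' g) : Realizes pf enc (M + M') g := by
  obtain ⟨c, hc, hc'⟩ := hf
  obtain ⟨e, he, he'⟩ := hg
  exact ⟨.comp c e, add_le_add hc he, fun d => by simp [Circuit.eval, hc', he']⟩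

theorem rewire {f : D → ο → Bit} (hf : Realizes pf enc M f) (w : τ → ο) :
    Realizes pf enc M fun d => f d ∘ w :=
  (hf.comp (wire w)).mono le_rfl

/-- More input wires do no harm. -/
theorem of_wire {ι' : Type} {enc' : D → ι' → Bit} {f : D → ο → Bit} (w : ι → ι')
    (h : ∀ d, enc d = enc' d ∘ w) (hf : Realizes pf enc M f) : Realizes pf enc' M f := by
  have h' : enc = fun d => enc' d ∘ w := funext h
  subst h'
  exact ((wire w).comp hf).mono (by omega)

theorem pair {f : D → ο → Bit} {g : D → τ → Bit} (hf : Realizes pf enc M f)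
    (hg : Realizes pf enc M' g) : Realizes pf enc (M + M') fun d => Sum.elim (f d) (g d) := by
  obtain ⟨c, hc, hc'⟩ := hf
  obtain ⟨e, he, he'⟩ := hg
  refine ⟨.comp (.wire (Sum.elim id id)) (.par c e), ?_, fun d => ?_⟩
  · simpa [Circuit.size] using add_le_add hc he
  · have h1 : (enc d ∘ Sum.elim id id) ∘ Sum.inl = enc d := rfl
    have h2 : (enc d ∘ Sum.elim id id) ∘ Sum.inr = enc d := rfl
    simp [Circuit.eval, h1, h2, hc', he', PMF.pure_map]

theorem fin_family : ∀ (n : ℕ) {f : D → Fin n → Bit},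
    (∀ i, Realizes pf enc M fun d (_ : Unit) => f d i) → Realizes pf enc (n * M) f
  | 0, f, _ => by
    have h0 := (wire (pf := pf) (enc := enc) (Fin.elim0 : Fin 0 → ι)).mono (Nat.zero_le (0 * M))
    have hf : f = fun d => enc d ∘ (Fin.elim0 : Fin 0 → ι) :=
      funext fun _ => Subsingleton.elim _ _
    rwa [hf]
  | n + 1, f, h => by
    have h1 := fin_family n (f := fun d i => f d i.succ) fun i => h i.succ
    have h2 := ((h 0).pair h1).rewire (Fin.cases (Sum.inl ()) Sum.inr : Fin (n + 1) → _)
    have hf : f = fun d => Sum.elim (fun _ : Unit => f d 0) (fun i => f d (Fin.succ i)) ∘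
        (Fin.cases (Sum.inl ()) Sum.inr : Fin (n + 1) → _) := by
      funext d i
      refine Fin.cases ?_ (fun i => ?_) i <;> simp
    rw [hf]
    exact h2.mono (by ring_nf; exact le_rfl)

theorem family [Fintype ο] {f : D → ο → Bit}
    (h : ∀ o, Realizes pf enc M fun d (_ : Unit) => f d o) :
    Realizes pf enc (Fintype.card ο * M) f := by
  have e := Fintype.equivFin ο
  have h1 := (fin_family (Fintype.card ο) (f := fun d i => f d (e.symm i)) fun i => h _).rewire e
  convert h1 using 2 with d
  funext i
  simp

theorem one : Realizes pf enc 1 fun _ (_ : Unit) => 1 :=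
  ⟨.comp (.wire Empty.elim) .one, le_rfl, fun d => by simp [Circuit.eval]⟩

theorem nand {f g : D → Bit} (hf : Realizes pf enc M fun d (_ : Unit) => f d)
    (hg : Realizes pf enc M' fun d (_ : Unit) => g d) :
    Realizes pf enc (M + M' + 1) fun d (_ : Unit) => 1 + f d * g d := by
  refine (hf.pair hg).comp
    ⟨.comp (.wire ![Sum.inl (), Sum.inr ()]) .nand, le_rfl, fun d => by simp [Circuit.eval]⟩

theorem mul {f g : D → Bit} (hf : Realizes pf enc M fun d (_ : Unit) => f d)
    (hg : Realizes pf enc M' fun d (_ : Unit) => g d) :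
    Realizes pf enc (M + M' + 2) fun d (_ : Unit) => f d * g d := by
  have h := (nand hf hg).comp (g := fun d (_ : Unit) => f d * g d) (M' := 1)
    ⟨.comp (.wire ![(), ()]) .nand, le_rfl, fun d => ?_⟩
  · exact h
  · have : ∀ x y : Bit, 1 + (1 + x * y) * (1 + x * y) = x * y := by decide
    simp [Circuit.eval, this]

theorem add {f g : D → Bit} (hf : Realizes pf enc M fun d (_ : Unit) => f d)
    (hg : Realizes pf enc M' fun d (_ : Unit) => g d) :
    Realizes pf enc (M + M' + 5) fun d (_ : Unit) => f d + g d := by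
  refine (hf.pair hg).comp (M' := 5) ?_
  set e : D → Unit ⊕ Unit → Bit := fun d => Sum.elim (fun _ => f d) (fun _ => g d)
  have hx : Realizes pf e 0 fun d (_ : Unit) => f d := wire (fun _ => Sum.inl ())
  have hy : Realizes pf e 0 fun d (_ : Unit) => g d := wire (fun _ => Sum.inr ())
  have hn := nand hx hy
  have h := nand (nand hx hn) (nand hy hn)
  have key : ∀ x y : Bit,
      1 + (1 + x * (1 + x * y)) * (1 + y * (1 + x * y)) = x + y := by decide
  simpa [key] using h

end Realizes

/-- The bit `f d` is computed from the bits `enc d` by a circuit of size at most `s.total ^ k`. -/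
def BitComp {s : Sizes} {D ι : Type} (pf : D → PublicFunctions s) (enc : D → ι → Bit) (k : ℕ)
    (f : D → Bit) : Prop :=
  Realizes pf enc (s.total ^ k) fun d (_ : Unit) => f d

open Classical in
/-- The truth value of `P d` is computed by a circuit of size at most `s.total ^ k`. -/
def PropComp {s : Sizes} {D ι : Type} (pf : D → PublicFunctions s) (enc : D → ι → Bit) (k : ℕ)
    (P : D → Prop) : Prop :=
  BitComp pf enc k fun d => if P d then 1 else 0

theorem Sizes.two_le_total (s : Sizes) [NeZero s.m] : 2 ≤ s.total := by
  have := NeZero.pos s.m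
  unfold Sizes.total
  omega

/-- A constant factor is absorbed by the exponent. -/
theorem Sizes.mul_pow_le (s : Sizes) [NeZero s.m] {c j k : ℕ} (hc : c ≤ 2 ^ j) :
    c * s.total ^ k ≤ s.total ^ (k + j) := by
  rw [pow_add, mul_comm]
  exact Nat.mul_le_mul_left _ (hc.trans (Nat.pow_le_pow_left s.two_le_total _))

theorem Sizes.pow_le (s : Sizes) {j k : ℕ} (h : j ≤ k) : s.total ^ j ≤ s.total ^ k :=
  Nat.pow_le_pow_right (by unfold Sizes.total; omega) h

theorem Sizes.one_le_pow (s : Sizes) (k : ℕ) : 1 ≤ s.total ^ k :=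
  Nat.one_le_pow _ _ (by unfold Sizes.total; omega)

namespace BitComp

variable {s : Sizes} {D ι ο E : Type} {pf : D → PublicFunctions s} {enc : D → ι → Bit}
  {a b k : ℕ} {f g : D → Bit}

theorem mono (h : BitComp pf enc a f) (hab : a ≤ b) : BitComp pf enc b f :=
  Realizes.mono h (s.pow_le hab)

theorem wire (i : ι) : BitComp pf enc 0 fun d => enc d i :=
  (Realizes.wire fun _ => i).mono (Nat.zero_le _)

theorem of_wire {ι' : Type} {enc' : D → ι' → Bit} (w : ι → ι')
    (h : ∀ d, enc d = enc' d ∘ w) (hf : BitComp pf enc k f) : BitComp pf enc' k f :=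
  Realizes.of_wire w h hf

theorem one : BitComp pf enc 0 fun _ => 1 := by
  simpa [BitComp] using (Realizes.one (pf := pf) (enc := enc))

/-- The bits of a small family are computed by one circuit. -/
theorem family [Fintype ο] {f : D → ο → Bit} (h : ∀ o, BitComp pf enc k fun d => f d o)
    (ho : Fintype.card ο ≤ s.total ^ a) : Realizes pf enc (s.total ^ (a + k)) f :=
  (Realizes.family h).mono (by rw [pow_add]; exact Nat.mul_le_mul_right _ ho)

variable [NeZero s.m]

theorem add (hf : BitComp pf enc k f) (hg : BitComp pf enc k g) :
    BitComp pf enc (k + 3) fun d => f d + g d := by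
  refine (Realizes.add hf hg).mono ?_
  have h1 := s.one_le_pow k
  have h2 := s.mul_pow_le (c := 7) (j := 3) (k := k) (by norm_num)
  omega

theorem zero : BitComp pf enc 3 fun _ => 0 := by
  have h := (one (pf := pf) (enc := enc)).add one
  have : (1 + 1 : Bit) = 0 := by decide
  simpa [this] using h

theorem mul (hf : BitComp pf enc k f) (hg : BitComp pf enc k g) :
    BitComp pf enc (k + 2) fun d => f d * g d := by
  refine (Realizes.mul hf hg).mono ?_
  have h1 := s.one_le_pow k
  have h2 := s.mul_pow_le (c := 4) (j := 2) (k := k) (by norm_num)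
  omega

theorem sum (S : Finset E) {f : E → D → Bit} (h : ∀ i ∈ S, BitComp pf enc k (f i))
    (hS : S.card ≤ s.total ^ a) : BitComp pf enc (a + k + 4) fun d => ∑ i ∈ S, f i d := by
  classical
  have key : Realizes pf enc (S.card * (s.total ^ k + 5) + 8)
      fun d (_ : Unit) => ∑ i ∈ S, f i d := by
    clear hS
    induction S using Finset.induction_on with
    | empty =>
      refine Realizes.mono (M := 7) ?_ (by omega)
      have h := (Realizes.one (pf := pf) (enc := enc)).add Realizes.one
      have h2 : (1 + 1 : Bit) = 0 := by decide
      simpa [h2] using h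
    | insert i S hi ih =>
      have h1 := (show Realizes pf enc (s.total ^ k) fun d (_ : Unit) => f i d from
        h i (by simp)).add (ih fun j hj => h j (by simp [hj]))
      simp_rw [Finset.sum_insert hi, Finset.card_insert_of_notMem hi]
      exact h1.mono (by ring_nf; omega)
  refine key.mono ?_
  have h1 := s.one_le_pow k
  have h2 : S.card * (s.total ^ k + 5) ≤ s.total ^ a * (6 * s.total ^ k) :=
    Nat.mul_le_mul hS (by omega)
  have h3 := s.mul_pow_le (c := 14) (j := 4) (k := a + k) (by norm_num)
  have h4 := s.one_le_pow (a + k)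
  rw [pow_add] at h3 h4
  nlinarith

theorem prod (S : Finset E) {f : E → D → Bit} (h : ∀ i ∈ S, BitComp pf enc k (f i))
    (hS : S.card ≤ s.total ^ a) : BitComp pf enc (a + k + 3) fun d => ∏ i ∈ S, f i d := by
  classical
  have key : Realizes pf enc (S.card * (s.total ^ k + 2) + 1)
      fun d (_ : Unit) => ∏ i ∈ S, f i d := by
    clear hS
    induction S using Finset.induction_on with
    | empty => simpa using (Realizes.one (pf := pf) (enc := enc))
    | insert i S hi ih =>
      have h1 := (show Realizes pf enc (s.total ^ k) fun d (_ : Unit) => f i d from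
        h i (by simp)).mul (ih fun j hj => h j (by simp [hj]))
      simp_rw [Finset.prod_insert hi, Finset.card_insert_of_notMem hi]
      exact h1.mono (by ring_nf; omega)
  refine key.mono ?_
  have h1 := s.one_le_pow k
  have h2 : S.card * (s.total ^ k + 2) ≤ s.total ^ a * (3 * s.total ^ k) :=
    Nat.mul_le_mul hS (by omega)
  have h3 := s.mul_pow_le (c := 4) (j := 3) (k := a + k) (by norm_num)
  have h4 := s.one_le_pow (a + k)
  rw [pow_add] at h3 h4
  nlinarith

theorem ite {P : D → Prop} [∀ d, Decidable (P d)] (hP : PropComp pf enc k P)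
    (hf : BitComp pf enc k f) (hg : BitComp pf enc k g) :
    BitComp pf enc (k + 8) fun d => if P d then f d else g d := by
  have hP' : BitComp pf enc k fun d => if P d then 1 else 0 := by
    unfold PropComp at hP
    convert hP
  have h1 := (hP'.mul hf).mono (b := k + 5) (by omega)
  have h2 := (((one.mono (Nat.zero_le _)).add hP').mul (hg.mono (by omega)))
  have h3 := h1.add h2
  convert h3 using 2 with d
  have : (1 + 1 : Bit) = 0 := by decide
  split_ifs <;> simp [this]

theorem hash {x : D → s.Elem} (hx : ∀ i, BitComp pf enc k fun d => x d i) (o : Fin s.κ) :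
    BitComp pf enc (k + 2) fun d => (pf d).hash (x d) o := by
  have h1 := family (a := 1) hx (by simp [Sizes.total]; omega)
  have h2 : Realizes pf x 1 fun d (_ : Unit) => (pf d).hash (x d) o :=
    ⟨.comp .hash (.wire fun _ => o), le_rfl, fun d => by simp [Circuit.eval]; rfl⟩
  refine (h1.comp h2).mono ?_
  have h1 := s.one_le_pow (1 + k)
  have h2 := s.mul_pow_le (c := 2) (j := 1) (k := 1 + k) (by norm_num)
  rw [show k + 2 = 1 + k + 1 by ring]
  omega

end BitComp

namespace PropComp

variable {s : Sizes} {D ι E : Type} {pf : D → PublicFunctions s} {enc : D → ι → Bit}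
  {a b k : ℕ} {P Q : D → Prop}

theorem mono (h : PropComp pf enc a P) (hab : a ≤ b) : PropComp pf enc b P :=
  BitComp.mono h hab

theorem of_wire {ι' : Type} {enc' : D → ι' → Bit} (w : ι → ι')
    (h : ∀ d, enc d = enc' d ∘ w) (hP : PropComp pf enc k P) : PropComp pf enc' k P :=
  Realizes.of_wire w h hP

variable [NeZero s.m]

theorem const (p : Prop) : PropComp pf enc 3 fun _ => p := by
  by_cases hp : p
  · simpa [PropComp, hp] using (BitComp.one (pf := pf) (enc := enc)).mono (b := 3) (by omega)
  · simpa [PropComp, hp] using (BitComp.zero (pf := pf) (enc := enc))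

theorem not (hP : PropComp pf enc k P) : PropComp pf enc (k + 3) fun d => ¬ P d := by
  have h := (BitComp.one.mono (Nat.zero_le _)).add hP
  unfold PropComp
  convert h using 2 with d
  have : (1 + 1 : Bit) = 0 := by decide
  by_cases h : P d <;> simp [h, this]

theorem and (hP : PropComp pf enc k P) (hQ : PropComp pf enc k Q) :
    PropComp pf enc (k + 2) fun d => P d ∧ Q d := by
  have h := BitComp.mul hP hQ
  unfold PropComp
  convert h using 2 with d
  by_cases h : P d <;> by_cases h' : Q d <;> simp [h, h']

theorem eq {f g : D → Bit} (hf : BitComp pf enc k f) (hg : BitComp pf enc k g) :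
    PropComp pf enc (k + 6) fun d => f d = g d := by
  have h := (BitComp.one.mono (Nat.zero_le _)).add (hf.add hg)
  unfold PropComp
  convert h using 2 with d
  have : ∀ x y : Bit, (if x = y then 1 else 0) = 1 + (x + y) := by decide
  rw [← this]
  congr

theorem all (S : Finset E) {P : E → D → Prop} (h : ∀ i ∈ S, PropComp pf enc k (P i))
    (hS : S.card ≤ s.total ^ a) : PropComp pf enc (a + k + 3) fun d => ∀ i ∈ S, P i d := by
  classical
  have h := BitComp.prod S h hS
  unfold PropComp
  convert h using 2 with d
  rw [Finset.prod_ite_zero]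
  simp

theorem ex (S : Finset E) {P : E → D → Prop} (h : ∀ i ∈ S, PropComp pf enc k (P i))
    (hS : S.card ≤ s.total ^ a) : PropComp pf enc (a + k + 9) fun d => ∃ i ∈ S, P i d := by
  have h := (all S (P := fun i d => ¬ P i d) (fun i hi => (h i hi).not) hS).not
  simpa [add_assoc] using h

/-- Equality of strings of length at most `s.total`. -/
theorem eq_str {w : ℕ} {x y : D → Str w} (hw : w ≤ s.total)
    (hx : ∀ i, BitComp pf enc k fun d => x d i) (hy : ∀ i, BitComp pf enc k fun d => y d i) :
    PropComp pf enc (k + 10) fun d => x d = y d := by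
  have h := all (a := 1) Finset.univ (fun i _ => eq (hx i) (hy i)) (by simpa using hw)
  simpa [funext_iff] using h.mono (b := k + 10) (by omega)

theorem bin {x : D → s.Elem} (hx : ∀ i, BitComp pf enc k fun d => x d i) (t : Fin 3)
    (b : s.Bin) : PropComp pf enc (k + 2) fun d => (pf d).bin t (x d) = b := by
  classical
  have h1 := BitComp.family (a := 1) hx (by simp [Sizes.total]; omega)
  have h2 : Realizes pf x 1 fun d (_ : Unit) => if (pf d).bin t (x d) = b then 1 else 0 :=
    ⟨.comp (.bin t) (.wire fun _ => b), le_rfl, fun d => by simp [Circuit.eval]; rfl⟩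
  have h3 := (h1.comp h2).mono (M' := s.total ^ (k + 2)) (by
    have h1 := s.one_le_pow (1 + k)
    have h2 := s.mul_pow_le (c := 2) (j := 1) (k := 1 + k) (by norm_num)
    rw [show k + 2 = 1 + k + 1 by ring]
    omega)
  unfold PropComp BitComp
  convert h3

theorem place {r : D → Str s.ρ} {x : D → s.Input} (hr : ∀ i, BitComp pf enc k fun d => r d i)
    (hx : ∀ t i, BitComp pf enc k fun d => x d t i) (b : s.Bin) (tk : Fin s.n × Fin 3) :
    PropComp pf enc (k + 4) fun d => (pf d).place (r d) (x d) b = some tk := by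
  classical
  have h1 := BitComp.family (a := 3)
    (f := fun d (w : Fin s.ρ ⊕ Fin s.n × Fin s.l) =>
      Sum.elim (r d) (fun ti => x d ti.1 ti.2) w) (enc := enc) (pf := pf) (k := k)
    (by rintro (i | ⟨t, i⟩); exacts [hr i, hx t i]) (by
      have h0 : s.ρ ≤ s.total := by unfold Sizes.total; omega
      have h1 : s.n * s.l ≤ s.total * s.total :=
        Nat.mul_le_mul (by unfold Sizes.total; omega) (by unfold Sizes.total; omega)
      have h2 := s.two_le_total
      simp only [Fintype.card_sum, Fintype.card_prod, Fintype.card_fin]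
      nlinarith [mul_le_mul h2 (le_refl (s.total * s.total)) (by positivity) (by positivity)])
  have h2 : Realizes pf (fun d (w : Fin s.ρ ⊕ Fin s.n × Fin s.l) =>
      Sum.elim (r d) (fun ti => x d ti.1 ti.2) w) 1
      fun d (_ : Unit) => if (pf d).place (r d) (x d) b = some tk then 1 else 0 :=
    ⟨.comp .place (.wire fun _ => (b, tk)), le_rfl, fun d => by simp [Circuit.eval]; rfl⟩
  have h3 := (h1.comp h2).mono (M' := s.total ^ (k + 4)) (by
    have h1 := s.one_le_pow (3 + k)
    have h2 := s.mul_pow_le (c := 2) (j := 1) (k := 3 + k) (by norm_num)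
    rw [show k + 4 = 3 + k + 1 by ring]
    omega)
  unfold PropComp BitComp
  convert h3

end PropComp

/-! ### Selecting the entries of a list that satisfy a condition -/

/-- The bits of a register with `N` slots that holds the list `L` (as far as it fits): for each slot
a bit telling whether it is occupied, and its contents. -/
def registerBits {w : ℕ} (N : ℕ) (L : List (Str w)) : Fin N × Option (Fin w) → Bit
  | (r, none) => if (L[r.val]?).isSome then 1 else 0
  | (r, some i) => ((L[r.val]?).getD 0) i

section Register

variable {s : Sizes} [NeZero s.m] {D ι E : Type} {pf : D → PublicFunctions s} {enc : D → ι → Bit}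
  {a b k w N : ℕ}

/-- The entries of a list that are present are collected by a shift register, into which they are
pushed one at a time. -/
theorem realizes_registerBits (hw : w + 1 ≤ s.total) (hN : N ≤ s.total ^ b) (l : List E)
    {opt : D → E → Option (Str w)}
    (hs : ∀ e ∈ l, PropComp pf enc k fun d => (opt d e).isSome)
    (hv : ∀ e ∈ l, ∀ i, BitComp pf enc k fun d => ((opt d e).getD 0) i) :
    Realizes pf enc ((l.length + 1) * s.total ^ (b + k + 12))
      fun d => registerBits N (l.filterMap (opt d)) := by
  induction l with
  | nil =>
    have h : Realizes pf enc (s.total ^ (b + 1 + 3))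
        fun d => registerBits N (([] : List E).filterMap (opt d)) := by
      refine BitComp.family (a := b + 1) ?_ ?_
      · rintro ⟨r, _ | i⟩ <;> simpa [registerBits] using BitComp.zero
      · simpa [pow_succ] using Nat.mul_le_mul hN hw
    exact h.mono (by
      have := s.pow_le (j := b + 1 + 3) (k := b + k + 12) (by omega)
      simpa using this)
  | cons e l ih =>
    have ih := ih (fun e he => hs e (by simp [he])) (fun e he => hv e (by simp [he]))
    set st : D → Fin N × Option (Fin w) → Bit := fun d => registerBits N (l.filterMap (opt d))
    have h1 := (Realizes.wire (pf := pf) (enc := enc) id).pair ih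
    set enc' : D → ι ⊕ Fin N × Option (Fin w) → Bit := fun d => Sum.elim (enc d ∘ id) (st d)
    have hflag : PropComp pf enc' k fun d => (opt d e).isSome :=
      PropComp.of_wire Sum.inl (fun _ => rfl) (hs e (by simp))
    have hval : ∀ i, BitComp pf enc' k fun d => ((opt d e).getD 0) i := fun i =>
      BitComp.of_wire Sum.inl (fun _ => rfl) (hv e (by simp) i)
    have hst : ∀ q, BitComp pf enc' 0 fun d => st d q := fun q => BitComp.wire (Sum.inr q)
    have h2 : Realizes pf enc' (s.total ^ (b + 1 + (k + 11)))
        fun d => registerBits N ((e :: l).filterMap (opt d)) := by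
      refine BitComp.family (a := b + 1) ?_ ?_
      · rintro ⟨⟨r, hr⟩, o⟩
        -- the bit that moves into this place when something is pushed
        have hpush : BitComp pf enc' (k + 3) fun d =>
            registerBits (r + 1) ((opt d e).getD 0 :: l.filterMap (opt d))
              (⟨r, Nat.lt_succ_self r⟩, o) := by
          rcases r with _ | r
          · cases o with
            | none => simpa [registerBits] using BitComp.one.mono (Nat.zero_le _)
            | some i => simpa [registerBits] using (hval i).mono (by omega)
          · refine BitComp.mono (a := 0) ?_ (by omega)
            convert hst (⟨r, by omega⟩, o) using 2 with d
            cases o <;> simp [st, registerBits]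
        have h := BitComp.ite (hflag.mono (b := k + 3) (by omega)) hpush
          ((hst (⟨r, hr⟩, o)).mono (Nat.zero_le _))
        convert h using 2 with d
        cases hd : opt d e <;> cases o <;> simp [st, registerBits, hd]
      · simpa [pow_succ] using Nat.mul_le_mul hN hw
    refine (h1.comp h2).mono ?_
    rw [show b + 1 + (k + 11) = b + k + 12 by ring, List.length_cons]
    ring_nf
    exact le_rfl

variable (hw : w + 1 ≤ s.total) (hN : N ≤ s.total ^ b) (l : List E)
    (hl : l.length + 1 ≤ s.total ^ a) {opt : D → E → Option (Str w)}
    (hs : ∀ e ∈ l, PropComp pf enc k fun d => (opt d e).isSome)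
    (hv : ∀ e ∈ l, ∀ i, BitComp pf enc k fun d => ((opt d e).getD 0) i)
include hw hN hl hs hv

theorem bitComp_registerBits (q : Fin N × Option (Fin w)) :
    BitComp pf enc (a + b + k + 12) fun d => registerBits N (l.filterMap (opt d)) q := by
  refine ((realizes_registerBits hw hN l hs hv).rewire fun _ => q).mono ?_
  rw [show a + b + k + 12 = a + (b + k + 12) by ring, pow_add _ a]
  exact Nat.mul_le_mul_right _ hl

theorem propComp_getElem_isSome (r : Fin N) :
    PropComp pf enc (a + b + k + 12) fun d => ((l.filterMap (opt d))[r.val]?).isSome := by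
  have h := bitComp_registerBits hw hN l hl hs hv (r, none)
  unfold PropComp
  convert h using 2 with d
  simp only [registerBits]
  split_ifs <;> rfl

theorem bitComp_getElem_getD (r : Fin N) (i : Fin w) :
    BitComp pf enc (a + b + k + 12) fun d => (((l.filterMap (opt d))[r.val]?).getD 0) i :=
  bitComp_registerBits hw hN l hl hs hv (r, some i)

end Register

/-! ### Circuits that sample -/

namespace PMF

theorem bind_map_uniformOfFintype (α β : Type*) [Fintype α] [Nonempty α] [Fintype β] [Nonempty β] :
    ((uniformOfFintype α).bind fun a => (uniformOfFintype β).map fun b => (a, b)) =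
      uniformOfFintype (α × β) := by
  classical
  ext ⟨a, b⟩
  rw [bind_apply, tsum_fintype, Finset.sum_eq_single a]
  · rw [map_apply, tsum_fintype, Finset.sum_eq_single b]
    · simp [ENNReal.mul_inv]
    · intro b' _ h
      simp [h.symm]
    · simp
  · intro a' _ h
    rw [map_apply, tsum_fintype, Finset.sum_eq_zero]
    · simp
    · intro b' _
      simp [h.symm]
  · simp

theorem map_uniformOfFintype_equiv {α β : Type*} [Fintype α] [Nonempty α] [Fintype β] [Nonempty β]
    (e : α ≃ β) : (uniformOfFintype α).map e = uniformOfFintype β := by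
  classical
  ext b
  rw [map_apply, tsum_fintype, Finset.sum_eq_single (e.symm b)]
  · simp [Fintype.card_congr e]
  · intro a _ h
    rw [if_neg]
    rintro rfl
    simp at h
  · simp

end PMF

/-- A circuit of size at most `M` without inputs outputs the bits `enc ω` of a uniformly distributed
`ω`. -/
def Samples (s : Sizes) {Ω ο : Type} [Fintype Ω] [Nonempty Ω] (M : ℕ) (enc : Ω → ο → Bit) : Prop :=
  ∃ c : Circuit s Empty ο, c.size ≤ M ∧
    ∀ pp x, c.eval pp x = (PMF.uniformOfFintype Ω).map enc

namespace Samples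

variable {s : Sizes} {Ω Ω' ο τ : Type} [Fintype Ω] [Nonempty Ω] [Fintype Ω'] [Nonempty Ω']
  {M M' : ℕ} {enc : Ω → ο → Bit} {enc' : Ω' → τ → Bit}

theorem mono (h : Samples s M enc) (hM : M ≤ M') : Samples s M' enc := by
  obtain ⟨c, hc, h⟩ := h
  exact ⟨c, hc.trans hM, h⟩

theorem prod (h : Samples s M enc) (h' : Samples s M' enc') :
    Samples s (M + M') fun ω : Ω × Ω' => Sum.elim (enc ω.1) (enc' ω.2) := by
  obtain ⟨c, hc, hc'⟩ := h
  obtain ⟨e, he, he'⟩ := h'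
  refine ⟨.comp (.wire (Sum.elim id id)) (.par c e), ?_, fun pp x => ?_⟩
  · simpa [Circuit.size] using add_le_add hc he
  · rw [← PMF.bind_map_uniformOfFintype]
    simp only [Circuit.eval, PMF.pure_bind, hc', he', PMF.map_bind, PMF.map_comp, PMF.bind_map]
    rfl

theorem equiv (h : Samples s M enc) (e : Ω' ≃ Ω) : Samples s M fun ω => enc (e ω) := by
  obtain ⟨c, hc, h⟩ := h
  refine ⟨c, hc, fun pp x => ?_⟩
  rw [h, ← PMF.map_uniformOfFintype_equiv e, PMF.map_comp]
  rfl

/-- Sampling followed by a deterministic computation. -/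
theorem realizes (h : Samples s M enc) {f : PublicFunctions s → Ω → τ → Bit}
    (hf : Realizes (D := PublicFunctions s × Ω) Prod.fst (fun d => enc d.2) M'
      fun d => f d.1 d.2) {f' : Ω → τ → Bit} (hf' : ∀ pp ω, f pp ω = f' ω) :
    Samples s (M + M') f' := by
  obtain ⟨c, hc, h⟩ := h
  obtain ⟨e, he, he'⟩ := hf
  refine ⟨.comp c e, add_le_add hc he, fun pp x => ?_⟩
  simp only [Circuit.eval, h, PMF.bind_map]
  rw [PMF.map]
  congr 1
  funext ω
  simpa [hf'] using he' (pp, ω)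

theorem rewire (h : Samples s M enc) (w : τ → ο) : Samples s M fun ω => enc ω ∘ w :=
  (h.realizes (f := fun _ ω => enc ω ∘ w) (Realizes.wire w) fun _ _ => rfl).mono le_rfl

theorem pick (k : ℕ) : Samples s (k + 1) fun (i : Fin (k + 1)) j => if j = i then 1 else 0 :=
  ⟨.pick k, le_rfl, fun _ _ => rfl⟩

theorem bit : Samples s 2 fun (x : Bit) (_ : Unit) => x := by
  have h := ((pick (s := s) 1).rewire fun _ : Unit => 1).equiv (Ω' := Bit)
    (Equiv.refl (Fin 2))
  have key : ∀ x : Fin 2, x = if 1 = x then 1 else 0 := by decide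
  convert h using 2 with x
  funext _
  exact key x

theorem fin_bits : ∀ n : ℕ, Samples s (2 * n) fun (x : Fin n → Bit) => x
  | 0 => ⟨.wire Fin.elim0, Nat.zero_le _, fun pp x => by
      have : (fun x : Fin 0 → Bit => x) = Function.const _ (x ∘ Fin.elim0) :=
        funext fun _ => Subsingleton.elim _ _
      rw [this, PMF.map_const]
      rfl⟩
  | n + 1 => by
    have h := ((bit.prod (fin_bits n)).equiv (Fin.consEquiv fun _ : Fin (n + 1) => Bit).symm).rewire
      (Fin.cases (Sum.inl ()) Sum.inr : Fin (n + 1) → _)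
    refine Samples.mono (M := 2 + 2 * n) ?_ (by omega)
    convert h using 2 with x
    funext i
    refine Fin.cases ?_ (fun i => ?_) i <;> simp [Fin.consEquiv, Fin.tail]

theorem bits (R : Type) [Fintype R] [DecidableEq R] :
    Samples s (2 * Fintype.card R) fun (x : R → Bit) => x := by
  have e := Fintype.equivFin R
  have h := ((fin_bits (s := s) (Fintype.card R)).equiv
    (Equiv.arrowCongr e (Equiv.refl Bit))).rewire e
  convert h using 2 with x
  funext i
  simp

end Samples

/-- The matrix of a permutation. -/
def permBits {α : Type} [DecidableEq α] (π : Equiv.Perm α) (q : α × α) : Bit :=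
  if π q.1 = q.2 then 1 else 0

/-- A uniform permutation of `Fin (n + 1)` is made of a uniform image of `0` and a uniform
permutation of `n` elements. -/
theorem samples_permBits_fin {s : Sizes} [NeZero s.m] {b : ℕ} : ∀ n, n ≤ s.total ^ b →
    Samples s (n * s.total ^ (3 * b + 20) + 1) (permBits (α := Fin n))
  | 0, _ => ⟨.wire fun q => q.1.elim0, Nat.zero_le _, fun pp x => by
      have : (permBits (α := Fin 0)) = Function.const _ (x ∘ fun q => q.1.elim0) :=
        funext fun _ => Subsingleton.elim _ _
      rw [this, PMF.map_const]
      rfl⟩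
  | n + 1, hn => by
    have ih := samples_permBits_fin (s := s) (b := b) n (by omega)
    have h1 := (Samples.pick (s := s) n).prod ih
    set en : Fin (n + 1) × Equiv.Perm (Fin n) → Fin (n + 1) ⊕ Fin n × Fin n → Bit :=
      fun ω => Sum.elim (fun j => if j = ω.1 then 1 else 0) (permBits ω.2)
    set pf : PublicFunctions s × Fin (n + 1) × Equiv.Perm (Fin n) → PublicFunctions s := Prod.fst
    have hp : ∀ j, PropComp pf (fun d => en d.2) 0 fun d => d.2.1 = j := fun j => by
      have h := BitComp.wire (pf := pf) (enc := fun d => en d.2) (Sum.inl j)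
      unfold PropComp
      convert h using 2 with d
      simp [en, eq_comm]
    have hM : ∀ i j, PropComp pf (fun d => en d.2) 0 fun d => d.2.2 i = j := fun i j => by
      have h := BitComp.wire (pf := pf) (enc := fun d => en d.2) (Sum.inr (i, j))
      unfold PropComp
      convert h using 2 with d
      simp only [en, permBits, Sum.elim_inr]
      split_ifs <;> rfl
    have h2 : Realizes pf (fun d => en d.2) (s.total ^ (2 * b + (b + 14)))
        fun d => permBits (Equiv.Perm.decomposeFin.symm d.2) := by
      refine BitComp.family (a := 2 * b) ?_ ?_
      · rintro ⟨i, j⟩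
        refine Fin.cases ?_ (fun i => ?_) i
        · have h := (hp j).mono (b := b + 14) (by omega)
          unfold PropComp at h
          convert h using 2 with d
          have h0 : d.2 = (d.2.1, d.2.2) := rfl
          rw [permBits, h0, Equiv.Perm.decomposeFin_symm_apply_zero]
          split_ifs <;> rfl
        refine Fin.cases ?_ (fun j => ?_) j
        · -- `i + 1` is mapped to `0` if the image of `0` is the successor of that of `i`
          have h := PropComp.ex (a := b) Finset.univ
            (P := fun (a : Fin n) (d : PublicFunctions s × Fin (n + 1) × Equiv.Perm (Fin n)) =>
              d.2.2 i = a ∧ d.2.1 = a.succ)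
            (fun a _ => (hM i a).and (hp a.succ)) (by simpa using (by omega : n ≤ s.total ^ b))
          have h := h.mono (b := b + 14) (by omega)
          unfold PropComp at h
          convert h using 2 with d
          have h0 : d.2 = (d.2.1, d.2.2) := rfl
          rw [permBits, h0, Equiv.Perm.decomposeFin_symm_apply_succ]
          congr 1
          simp only [Finset.mem_univ, true_and, exists_eq_left', eq_iff_iff,
            Equiv.swap_apply_eq_iff, Equiv.swap_apply_left]
          exact eq_comm
        · have h := ((hM i j).mono (b := 3) (by omega)).and (hp j.succ).not
          have h := h.mono (b := b + 14) (by omega)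
          unfold PropComp at h
          convert h using 2 with d
          have h0 : d.2 = (d.2.1, d.2.2) := rfl
          rw [permBits, h0, Equiv.Perm.decomposeFin_symm_apply_succ]
          congr 1
          simp only [eq_iff_iff]
          constructor
          · intro h
            rw [Equiv.swap_apply_def, if_neg (Fin.succ_ne_zero _)] at h
            split_ifs at h with h'
            · exact absurd h.symm (Fin.succ_ne_zero j)
            · have := Fin.succ_injective _ h
              exact ⟨this, fun h'' => h' (by rw [this, h''])⟩
          · rintro ⟨h, h'⟩
            rw [h]
            exact Equiv.swap_apply_of_ne_of_ne (Fin.succ_ne_zero _) (Ne.symm h')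
      · simp only [Fintype.card_prod, Fintype.card_fin]
        rw [two_mul, pow_add]
        exact Nat.mul_le_mul hn hn
    have h3 := (h1.realizes (f := fun _ ω => permBits (Equiv.Perm.decomposeFin.symm ω)) h2
      fun _ _ => rfl).equiv Equiv.Perm.decomposeFin
    simp only [Equiv.symm_apply_apply] at h3
    refine h3.mono ?_
    have e1 := s.pow_le (j := b) (k := 3 * b + 14) (by omega)
    have e2 := s.mul_pow_le (c := 2) (j := 6) (k := 3 * b + 14) (by norm_num)
    rw [show 2 * b + (b + 14) = 3 * b + 14 by ring]
    have e3 : 3 * b + 14 + 6 = 3 * b + 20 := by ring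
    rw [e3] at e2
    nlinarith

theorem samples_permBits {s : Sizes} [NeZero s.m] {b : ℕ} (α : Type) [Fintype α] [DecidableEq α]
    (h : Fintype.card α ≤ s.total ^ b) :
    Samples s (s.total ^ (4 * b + 21)) (permBits (α := α)) := by
  have e := Fintype.equivFin α
  have h1 := ((samples_permBits_fin (s := s) _ h).equiv e.permCongr).rewire
    fun q : α × α => (e q.1, e q.2)
  refine Samples.mono (M := Fintype.card α * s.total ^ (3 * b + 20) + 1) ?_ ?_
  · convert h1 using 2 with π
    funext q
    simp [permBits]
  · have e1 := s.one_le_pow (4 * b + 20)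
    have e2 := s.mul_pow_le (c := 2) (j := 1) (k := 4 * b + 20) (by norm_num)
    rw [show 4 * b + 20 + 1 = 4 * b + 21 by ring] at e2
    have e3 : Fintype.card α * s.total ^ (3 * b + 20) ≤ s.total ^ (4 * b + 20) := by
      rw [show 4 * b + 20 = b + (3 * b + 20) by ring, pow_add _ b]
      exact Nat.mul_le_mul_right _ h
    omega

/-! ### What the shares of an execution add up to -/

theorem Str.add_self {k : ℕ} (x : Str k) : x + x = 0 := by
  funext i
  exact CharTwo.add_self_eq_zero (x i)

theorem mem_simpleTable {s : Sizes} {pp : PublicFunctions s} {x : s.Input} {b : s.Bin}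
    {it : s.Item} : it ∈ simpleTable pp x b ↔ it.1 ∈ elems x ∧ pp.bin it.2 it.1 = b := by
  obtain ⟨y, k⟩ := it
  simp [simpleTable, elems]

theorem mem_unionOf {s : Sizes} {X : s.Party → s.Input} {x : s.Elem} :
    x ∈ unionOf X ↔ ∃ j, x ∈ elems (X j) := by
  simp [unionOf]

theorem encodeElem_injective {s : Sizes} {pp : PublicFunctions s} :
    Function.Injective (encodeElem pp) := by
  intro x y h
  funext i
  have := congrFun h (Fin.castAdd _ i)
  simpa [encodeElem] using this

theorem exists_first {s : Sizes} {X : s.Party → s.Input} {x : s.Elem} (hx : x ∈ unionOf X) :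
    ∃ j, x ∈ elems (X j) ∧ ∀ i < j, x ∉ elems (X i) := by
  obtain ⟨j, hj⟩ := mem_unionOf.1 hx
  induction j using WellFoundedLT.induction with
  | ind j ih =>
    by_cases h : ∃ i < j, x ∈ elems (X i)
    · obtain ⟨i, hi, hx⟩ := h
      exact ih i hi hx
    · push Not at h
      exact ⟨j, hj, h⟩

section Execution

variable {s : Sizes} [NeZero s.m] (pp : PublicFunctions s) (X : s.Party → s.Input) (ω : Coins s)

/-- The result of the membership test between the simple table of party `i` and the Cuckoo table of
party `j` in bin `b`. -/
def Member (i j : s.Party) (b : s.Bin) : Prop :=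
  ∃ it ∈ simpleTable pp (X i) b, cuckooTable pp X ω j b = some it

/-- The mask that the mss-ROT for `i < j` and bin `b` adds when the membership test is positive. -/
def maskSum (j i : s.Party) (b : s.Bin) : s.Block :=
  ∑ d ∈ Finset.univ.filter fun d => d ≠ 0 ∧ d ≤ j, ω.delta d j i b

open Classical in
/-- The value that is shared among the parties for bin `b` of party `j`: an element with its hash
value, masked if an earlier party has the element too, or random if the bin is empty. -/
noncomputable def sharedValue (j : s.Party) (b : s.Bin) : s.Block :=
  match cuckooTable pp X ω j b with
  | some it => encodeElem pp it.1 +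
      ∑ i ∈ Finset.univ.filter (· < j), if Member pp X ω i j b then maskSum ω j i b else 0
  | none => ∑ i ∈ Finset.univ.filter (· < j), ω.rot j i b j + ω.pad j b

variable {pp X ω}

theorem sharedValue_some {j : s.Party} {b : s.Bin} {it : s.Item}
    (h : cuckooTable pp X ω j b = some it) [∀ i, Decidable (Member pp X ω i j b)] :
    sharedValue pp X ω j b = encodeElem pp it.1 +
      ∑ i ∈ Finset.univ.filter (· < j), if Member pp X ω i j b then maskSum ω j i b else 0 := by
  rw [sharedValue, h]
  congr!

theorem sharedValue_none {j : s.Party} {b : s.Bin} (h : cuckooTable pp X ω j b = none) :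
    sharedValue pp X ω j b =
      ∑ i ∈ Finset.univ.filter (· < j), ω.rot j i b j + ω.pad j b := by
  rw [sharedValue, h]

theorem sharedValue_of_forall_not_member {j : s.Party} {b : s.Bin} {it : s.Item}
    (h : cuckooTable pp X ω j b = some it) (hm : ∀ i < j, ¬ Member pp X ω i j b) :
    sharedValue pp X ω j b = encodeElem pp it.1 := by
  classical
  rw [sharedValue_some h, Finset.sum_eq_zero, add_zero]
  intro i hi
  rw [if_neg (hm i (by simpa using hi))]

theorem not_member_of_none {i j : s.Party} {b : s.Bin} (h : cuckooTable pp X ω j b = none) :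
    ¬ Member pp X ω i j b := by
  rintro ⟨it, -, h'⟩
  simp [h] at h'

theorem pmtOut_lt {i j : s.Party} (h : i < j) (b : s.Bin) :
    pmtOut pp X ω i j b = ω.pmt i j b := by
  simp [pmtOut, h, bssPMT]

open Classical in
theorem pmtOut_gt {i j : s.Party} (h : i < j) (b : s.Bin) :
    pmtOut pp X ω j i b = ω.pmt i j b + if Member pp X ω i j b then 1 else 0 := by
  simp only [pmtOut, h, h.not_gt, if_true, if_false, bssPMT, Member]
  congr

open Classical in
theorem pmtOut_add {i j : s.Party} (h : i < j) (b : s.Bin) :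
    pmtOut pp X ω i j b + pmtOut pp X ω j i b = if Member pp X ω i j b then 1 else 0 := by
  rw [pmtOut_lt h, pmtOut_gt h, ← add_assoc, CharTwo.add_self_eq_zero, zero_add]

open Classical in
/-- The output of an mss-ROT in terms of its coins, the membership test and the masks. -/
theorem rotOut_eq {i j : s.Party} (h : i < j) (d : s.Party) (b : s.Bin) :
    rotOut pp X ω d j i b =
      if d = min 1 i then
        ∑ e ∈ (Finset.Icc (min 1 i) j).erase (min 1 i), ω.rot j i b e +
          if Member pp X ω i j b then maskSum ω j i b else 0
      else if d ∈ Finset.Icc (min 1 i) j then ω.rot j i b d else 0 := by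
  rw [rotOut, if_pos h, mssROT, pmtOut_add h, maskSum]
  by_cases hm : Member pp X ω i j b <;> simp [hm]

open Classical in
theorem sum_rotOut {i j : s.Party} (h : i < j) (b : s.Bin) :
    ∑ d, rotOut pp X ω d j i b = if Member pp X ω i j b then maskSum ω j i b else 0 := by
  set Q := Finset.Icc (min 1 i) j with hQ
  rw [← Finset.add_sum_erase _ _ (Finset.mem_univ (min 1 i)), rotOut_eq h, if_pos rfl]
  have h1 : ∑ d ∈ Finset.univ.erase (min 1 i), rotOut pp X ω d j i b =
      ∑ d ∈ Q.erase (min 1 i), ω.rot j i b d := by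
    rw [← Finset.sum_subset (Finset.erase_subset_erase _ (Finset.subset_univ Q))]
    · refine Finset.sum_congr rfl fun d hd => ?_
      rw [Finset.mem_erase] at hd
      rw [rotOut_eq h, if_neg hd.1, if_pos hd.2]
    · intro d hd hd'
      rw [Finset.mem_erase] at hd hd'
      rw [rotOut_eq h, if_neg hd.1, if_neg fun h => hd' ⟨hd.1, h⟩]
  rw [h1, add_right_comm, Str.add_self, zero_add]

theorem rotOut_self {i j : s.Party} (h : i < j) (b : s.Bin) :
    rotOut pp X ω j j i b = ω.rot j i b j := by
  have h1 : j ≠ min 1 i := ((min_le_right _ _).trans_lt h).ne'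
  rw [rotOut_eq h, if_neg h1, if_pos (Finset.mem_Icc.2 ⟨(min_le_right _ _).trans h.le, le_rfl⟩)]

theorem rotOut_eq_zero {i j d : s.Party} (h : j < d) (b : s.Bin) :
    rotOut pp X ω d j i b = 0 := by
  by_cases hi : i < j
  · rw [rotOut_eq hi, if_neg, if_neg]
    · simp [h]
    · exact ((min_le_right _ _).trans_lt (hi.trans h)).ne'
  · rw [rotOut, if_neg hi]

/-- The parties' shares for a bin add up to `sharedValue`. -/
theorem sum_shareOut (j : s.Party) (b : s.Bin) :
    ∑ d, shareOut pp X ω d j b = sharedValue pp X ω j b := by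
  classical
  have hsum : ∑ d, ∑ i ∈ Finset.univ.filter (· < j), rotOut pp X ω d j i b =
      ∑ i ∈ Finset.univ.filter (· < j), if Member pp X ω i j b then maskSum ω j i b else 0 := by
    rw [Finset.sum_comm]
    exact Finset.sum_congr rfl fun i hi => sum_rotOut (by simpa using hi) b
  have hshare : ∀ (v : s.Block), (∀ d, shareOut pp X ω d j b =
      ∑ i ∈ Finset.univ.filter (· < j), rotOut pp X ω d j i b + if d = j then v else 0) →
      ∑ d, shareOut pp X ω d j b = (∑ i ∈ Finset.univ.filter (· < j),
        if Member pp X ω i j b then maskSum ω j i b else 0) + v := by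
    intro v hv
    rw [Finset.sum_congr rfl fun d _ => hv d, Finset.sum_add_distrib, hsum]
    simp
  have hlarge : ∀ d, ¬ d < j → d ≠ j →
      ∑ i ∈ Finset.univ.filter (· < j), rotOut pp X ω d j i b = 0 := fun d h1 h2 =>
    Finset.sum_eq_zero fun i _ => rotOut_eq_zero (lt_of_le_of_ne (not_lt.1 h1) h2.symm) b
  cases h : cuckooTable pp X ω j b with
  | some it =>
    rw [sharedValue_some h, hshare (encodeElem pp it.1), add_comm]
    intro d
    by_cases h1 : d < j
    · simp [shareOut, h1, h1.ne]
    · by_cases h2 : d = j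
      · subst h2
        simp [shareOut, h]
      · simp [shareOut, h1, h2, hlarge d h1 h2]
  | none =>
    rw [sharedValue_none h, hshare (∑ i ∈ Finset.univ.filter (· < j), ω.rot j i b j + ω.pad j b),
      Finset.sum_eq_zero, zero_add]
    · intro i _
      rw [if_neg (not_member_of_none h)]
    intro d
    by_cases h1 : d < j
    · simp [shareOut, h1, h1.ne]
    · by_cases h2 : d = j
      · subst h2
        have h3 : ∑ i ∈ Finset.univ.filter (· < d), rotOut pp X ω d d i b =
            ∑ i ∈ Finset.univ.filter (· < d), ω.rot d i b d :=
          Finset.sum_congr rfl fun i hi => rotOut_self (by simpa using hi) b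
        simp [shareOut, h, h3, ← add_assoc, Str.add_self]
      · simp [shareOut, h1, h2, hlarge d h1 h2]

theorem sum_shuffleOut (p : s.Pos) :
    ∑ i, shuffleOut pp X ω i p = sharedValue pp X ω (ω.perm p).1 (ω.perm p).2 := by
  rw [← Finset.add_sum_erase _ _ (Finset.mem_univ (0 : s.Party))]
  have h : ∑ i ∈ Finset.univ.erase 0, shuffleOut pp X ω i p =
      ∑ i ∈ Finset.univ.erase 0, ω.share i p :=
    Finset.sum_congr rfl fun i hi => by simp [shuffleOut, shuffle, Finset.ne_of_mem_erase hi]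
  rw [h, shuffleOut, shuffle, if_pos rfl, add_assoc, Str.add_self, add_zero, sum_shareOut]

theorem mem_leaderOut {x : s.Elem} : x ∈ leaderOut pp X ω ↔
    x ∈ elems (X 0) ∨ ∃ q : s.Pos, sharedValue pp X ω q.1 q.2 = encodeElem pp x := by
  simp only [leaderOut, Finset.mem_union, Finset.mem_filter, Finset.mem_univ, true_and,
    sum_shuffleOut]
  exact or_congr_right
    (ω.perm.surjective.exists (p := fun q => sharedValue pp X ω q.1 q.2 = encodeElem pp x)).symm

/-! ### Consequences of successful Cuckoo hashing -/

variable (pp X ω) in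
/-- Cuckoo hashing succeeds for all parties that perform it. -/
def CuckooSucceeds : Prop :=
  ∀ j : s.Party, j ≠ 0 → IsCuckoo pp (X j) (pp.place (ω.cuckoo j) (X j))

variable (pp X ω) in
/-- The value for a bin is masked by fresh randomness: the bin is empty, or an earlier party has its
element as well. -/
def Masked (j : s.Party) (b : s.Bin) : Prop :=
  cuckooTable pp X ω j b = none ∨ ∃ i < j, Member pp X ω i j b

theorem sharedValue_of_not_masked {j : s.Party} {b : s.Bin} (h : ¬ Masked pp X ω j b) :
    ∃ it, cuckooTable pp X ω j b = some it ∧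
      sharedValue pp X ω j b = encodeElem pp it.1 := by
  rw [Masked, not_or] at h
  obtain ⟨it, hit⟩ := Option.ne_none_iff_exists'.1 h.1
  exact ⟨it, hit, sharedValue_of_forall_not_member hit fun i hi hm => h.2 ⟨i, hi, hm⟩⟩

theorem cuckooTable_eq_some {j : s.Party} {b : s.Bin} {it : s.Item} :
    cuckooTable pp X ω j b = some it ↔
      ∃ t, pp.place (ω.cuckoo j) (X j) b = some (t, it.2) ∧ X j t = it.1 := by
  rw [cuckooTable, Option.map_eq_some_iff]
  constructor
  · rintro ⟨⟨t, k⟩, h, rfl⟩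
    exact ⟨t, h, rfl⟩
  · rintro ⟨t, h, h'⟩
    exact ⟨_, h, Prod.ext h' rfl⟩

theorem mem_elems_of_cuckooTable {j : s.Party} {b : s.Bin} {it : s.Item}
    (h : cuckooTable pp X ω j b = some it) : it.1 ∈ elems (X j) := by
  obtain ⟨t, -, h⟩ := cuckooTable_eq_some.1 h
  exact Finset.mem_image.2 ⟨t, Finset.mem_univ _, h⟩

theorem member_iff {i j : s.Party} {b : s.Bin} {it : s.Item} (hω : CuckooSucceeds pp X ω)
    (hj : j ≠ 0) (h : cuckooTable pp X ω j b = some it) :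
    Member pp X ω i j b ↔ it.1 ∈ elems (X i) := by
  obtain ⟨t, ht, ht'⟩ := cuckooTable_eq_some.1 h
  have hb := (hω j hj).1 b t it.2 ht
  rw [ht'] at hb
  simp [Member, h, mem_simpleTable, hb]

theorem exists_cuckooTable_eq_some {j : s.Party} {x : s.Elem} (hω : CuckooSucceeds pp X ω)
    (hj : j ≠ 0) (hx : x ∈ elems (X j)) : ∃ b it, cuckooTable pp X ω j b = some it ∧ it.1 = x := by
  obtain ⟨t, -, rfl⟩ := Finset.mem_image.1 hx
  obtain ⟨b, ⟨k, hk⟩, -⟩ := (hω j hj).2 t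
  exact ⟨b, (X j t, k), cuckooTable_eq_some.2 ⟨t, hk, rfl⟩, rfl⟩

theorem cuckooTable_bin_unique {j : s.Party} {b b' : s.Bin} {it it' : s.Item}
    (hω : CuckooSucceeds pp X ω) (hX : Function.Injective (X j)) (hj : j ≠ 0)
    (h : cuckooTable pp X ω j b = some it) (h' : cuckooTable pp X ω j b' = some it')
    (hit : it.1 = it'.1) : b = b' := by
  obtain ⟨t, ht, htx⟩ := cuckooTable_eq_some.1 h
  obtain ⟨t', ht', htx'⟩ := cuckooTable_eq_some.1 h'
  obtain rfl : t = t' := hX (by rw [htx, htx', hit])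
  exact ((hω j hj).2 t).unique ⟨_, ht⟩ ⟨_, ht'⟩

/-- An element occurs unmasked in the table of the first party that has it. -/
theorem exists_not_masked {x : s.Elem} (hω : CuckooSucceeds pp X ω) {j : s.Party} (hj : j ≠ 0)
    (hx : x ∈ elems (X j)) (hlt : ∀ i < j, x ∉ elems (X i)) :
    ∃ b it, cuckooTable pp X ω j b = some it ∧ it.1 = x ∧ ¬ Masked pp X ω j b := by
  obtain ⟨b, it, h, rfl⟩ := exists_cuckooTable_eq_some hω hj hx
  refine ⟨b, it, h, rfl, ?_⟩
  rintro (h' | ⟨i, hi, hm⟩)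
  · simp [h] at h'
  · exact hlt i hi ((member_iff hω hj h).1 hm)

/-- The leader finds the union, unless a masked value looks like an element with its hash value. -/
theorem leaderOut_eq_unionOf (hω : CuckooSucceeds pp X ω)
    (h : ∀ q : s.Pos, Masked pp X ω q.1 q.2 →
      ∀ x, sharedValue pp X ω q.1 q.2 ≠ encodeElem pp x) : leaderOut pp X ω = unionOf X := by
  ext x
  rw [mem_leaderOut]
  constructor
  · rintro (hx | ⟨q, hq⟩)
    · exact mem_unionOf.2 ⟨0, hx⟩
    · obtain ⟨it, hit, hv⟩ := sharedValue_of_not_masked fun hm => h q hm x hq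
      rw [hv] at hq
      rw [← encodeElem_injective hq]
      exact mem_unionOf.2 ⟨_, mem_elems_of_cuckooTable hit⟩
  · intro hx
    obtain ⟨j, hj, hlt⟩ := exists_first hx
    by_cases hj0 : j = 0
    · exact Or.inl (hj0 ▸ hj)
    · obtain ⟨b, it, hit, rfl, hm⟩ := exists_not_masked hω hj0 hj hlt
      refine Or.inr ⟨(⟨j, hj0⟩, b), ?_⟩
      obtain ⟨it', hit', hv⟩ := sharedValue_of_not_masked hm
      rw [hit] at hit'
      cases hit'
      exact hv

end Execution

/-! ### The simulated view -/

section Simulation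

variable {s : Sizes} [NeZero s.m] (pp : PublicFunctions s) (X : s.Party → s.Input)
  (C : Finset s.Party) (p : s.Party) (ω : Coins s)

open Classical in
/-- The bits from the membership tests, simulated without the inputs of honest parties: a test with
an honest sender is replaced by a negative one. -/
noncomputable def simPmt (c k : s.Party) (b : s.Bin) : Bit :=
  if c < k then ω.pmt c k b
  else if k < c then ω.pmt k c b + if k ∈ C ∧ Member pp X ω k c b then 1 else 0
  else 0

open Classical in
/-- The outputs of mss-ROT, simulated: the mask is only added if all the parties involved are
corrupted. -/
noncomputable def simRot (d j i : s.Party) (b : s.Bin) : s.Block :=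
  if i < j then
    if d = min 1 i then
      ∑ e ∈ (Finset.Icc (min 1 i) j).erase (min 1 i), ω.rot j i b e +
        if Finset.Icc (min 1 i) j ⊆ C ∧ Member pp X ω i j b then maskSum ω j i b else 0
    else if d ∈ Finset.Icc (min 1 i) j then ω.rot j i b d else 0
  else 0

/-- The output of the shuffle for the permuted vector `vec`. -/
def simShare (vec : s.Pos → s.Block) (i : s.Party) (q : s.Pos) : s.Block :=
  if i = 0 then vec (ω.perm q) + ∑ k ∈ Finset.univ.erase 0, ω.share k q else ω.share i q

/-- The view of party `c`, simulated with `vec` in place of the vector that the parties share. -/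
noncomputable def viewWith (vec : s.Pos → s.Block) (c : s.Party) : ViewWire s → Bit
  | .input t a => X c t a
  | .cuckoo a => ω.cuckoo c a
  | .delta j i b a => ω.delta c j i b a
  | .pad b a => ω.pad c b a
  | .pmt k b => simPmt pp X C ω c k b
  | .rot j i b a => simRot pp X C ω c j i b a
  | .shuffled q a => simShare ω vec c q a
  | .message k q a => if c = 0 then simShare ω vec k q a else 0

/-- Given the view of the corrupted parties, among them the leader, the value for bin `b` of party
`j` is uniform: the bin is empty and `j` is honest, or the value is masked with the help of an
honest party. Here `p` stands for the first honest party. -/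
def Hidden (j : s.Party) (b : s.Bin) : Prop :=
  0 ∈ C ∧ ((j ∉ C ∧ cuckooTable pp X ω j b = none) ∨ (¬ j < p ∧ ∃ i < j, Member pp X ω i j b))

open Classical in
/-- The shared vector, with its hidden entries replaced by random values. The coins
`ω.delta p j j b` are used for that, which the protocol never looks at. -/
noncomputable def hybridVec (q : s.Pos) : s.Block :=
  if Hidden pp X C p ω q.1 q.2 then ω.delta p q.1 q.1 q.2 else sharedValue pp X ω q.1 q.2

open Classical in
/-- The entries of the shared vector that are not hidden. -/
noncomputable def knownValue (q : s.Pos) : Option s.Block :=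
  if Hidden pp X C p ω q.1 q.2 then none else some (sharedValue pp X ω q.1 q.2)

open Classical in
/-- What the simulator knows of the vector, as a family with repetitions: the values that it can
compute from the simulated views (all bins of parties `j` such that the parties up to `j` are
corrupted, and the empty bins of other corrupted parties), and the encodings of the elements of
the union `U` that do not belong to one of the parties before `p`. -/
noncomputable def simItem (U : Finset s.Elem) : s.Pos ⊕ Fin (s.m * s.n) → Option s.Block
  | .inl q =>
    if q.1.1 < p ∨ (q.1.1 ∈ C ∧ cuckooTable pp X ω q.1 q.2 = none) then
      some (sharedValue pp X ω q.1 q.2)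
    else none
  | .inr r =>
    if r.val < U.toList.length ∧ ∀ j < p, U.toList.getD r.val 0 ∉ elems (X j) then
      some (encodeElem pp (U.toList.getD r.val 0))
    else none

/-- The entries that the simulator knows, in one list. -/
noncomputable def simList (U : Finset s.Elem) : List s.Block :=
  (Finset.univ : Finset (s.Pos ⊕ Fin (s.m * s.n))).toList.filterMap (simItem pp X C p ω U)

/-- The simulated vector before permuting: first the known entries, then random values. -/
noncomputable def simVec (U : Finset s.Elem) (q : s.Pos) : s.Block :=
  ((simList pp X C p ω U)[(Fintype.equivFin s.Pos q).val]?).getD (ω.delta p q.1 q.1 q.2)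

variable {pp X C p ω} {ω' : Coins s}

theorem cuckooTable_congr (h : ω'.cuckoo = ω.cuckoo) :
    cuckooTable pp X ω' = cuckooTable pp X ω := by
  funext j b
  rw [cuckooTable, cuckooTable, h]

theorem member_congr (h : ω'.cuckoo = ω.cuckoo) : Member pp X ω' = Member pp X ω := by
  funext i j b
  rw [Member, Member, cuckooTable_congr h]

theorem hidden_congr (h : ω'.cuckoo = ω.cuckoo) : Hidden pp X C p ω' = Hidden pp X C p ω := by
  funext j b
  rw [Hidden, Hidden, cuckooTable_congr h, member_congr h]

/-- `sharedValue` is a sum that contains the coins of the masks once. -/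
theorem sharedValue_sub_of_delta {j : s.Party} {b : s.Bin} {i₀ d₀ : s.Party}
    (hc : ω'.cuckoo = ω.cuckoo) (hi : i₀ < j) (hd₀ : d₀ ≠ 0) (hd : d₀ ≤ j)
    (hm : Member pp X ω i₀ j b)
    (h : ∀ d i, i < j → ¬ (d = d₀ ∧ i = i₀) → ω'.delta d j i b = ω.delta d j i b) :
    sharedValue pp X ω' j b - sharedValue pp X ω j b =
      ω'.delta d₀ j i₀ b - ω.delta d₀ j i₀ b := by
  classical
  obtain ⟨it, -, hit⟩ := id hm
  have hit' : cuckooTable pp X ω' j b = some it := by rw [cuckooTable_congr hc, hit]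
  rw [sharedValue_some hit, sharedValue_some hit', add_sub_add_left_eq_sub,
    ← Finset.sum_sub_distrib, Finset.sum_eq_single i₀]
  · rw [member_congr hc, if_pos hm, if_pos hm, maskSum, maskSum, ← Finset.sum_sub_distrib,
      Finset.sum_eq_single d₀]
    · intro d _ hd
      rw [h d i₀ hi fun h => hd h.1, sub_self]
    · intro h
      simp [hd₀, hd] at h
  · intro i hi hne
    rw [member_congr hc, maskSum, maskSum, Finset.sum_congr rfl fun d _ =>
      h d i (by simpa using hi) fun h => hne h.2, sub_self]
  · intro h
    simp [hi] at h

theorem sharedValue_congr {j : s.Party} {b : s.Bin} (hc : ω'.cuckoo = ω.cuckoo)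
    (hsome : ∀ i < j, Member pp X ω i j b → maskSum ω' j i b = maskSum ω j i b)
    (hnone : cuckooTable pp X ω j b = none →
      ω'.pad j b = ω.pad j b ∧ ∀ i < j, ω'.rot j i b j = ω.rot j i b j) :
    sharedValue pp X ω' j b = sharedValue pp X ω j b := by
  classical
  cases h : cuckooTable pp X ω j b with
  | some it =>
    rw [sharedValue_some h, sharedValue_some (by rw [cuckooTable_congr hc, h]), member_congr hc]
    congr 1
    refine Finset.sum_congr rfl fun i hi => ?_
    split_ifs with hm
    · exact hsome i (by simpa using hi) hm
    · rfl
  | none =>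
    rw [sharedValue_none h, sharedValue_none (by rw [cuckooTable_congr hc, h]), (hnone h).1]
    congr 1
    exact Finset.sum_congr rfl fun i hi => (hnone h).2 i (by simpa using hi)

/-! ### From the real view to a view with random hidden values -/

open Classical in
variable (pp X ω) in
/-- An earlier party that has the element in bin `b` of party `j`, if there is one. -/
noncomputable def maskSource (j : s.Party) (b : s.Bin) : s.Party :=
  if h : ∃ i < j, Member pp X ω i j b then h.choose else 0

theorem maskSource_spec {j : s.Party} {b : s.Bin} (h : ∃ i < j, Member pp X ω i j b) :
    maskSource pp X ω j b < j ∧ Member pp X ω (maskSource pp X ω j b) j b := by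
  rw [maskSource, dif_pos h]
  exact h.choose_spec

open Classical in
variable (C) in
/-- An honest party that is involved in the mss-ROT for `i < j`, if there is one. -/
noncomputable def rotSource (i j : s.Party) : s.Party :=
  if h : ∃ e ∈ Finset.Icc (min 1 i) j, e ∉ C then h.choose else 0

theorem rotSource_spec {i j : s.Party} (h : ¬ Finset.Icc (min 1 i) j ⊆ C) :
    rotSource C i j ∈ Finset.Icc (min 1 i) j ∧ rotSource C i j ∉ C := by
  have h' := Finset.not_subset.1 h
  rw [rotSource, dif_pos h']
  exact h'.choose_spec

open Classical in
variable (pp X C p ω) in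
/-- The coins with which the view is simulated, as a function of the real coins. Coins of honest
parties absorb the data that depend on honest inputs, and the hidden values trade places with a
coin of their mask or with their padding. -/
noncomputable def hybridCoins : Coins s where
  cuckoo := ω.cuckoo
  delta d j i b :=
    if d = p ∧ Hidden pp X C p ω j b then
      if i = j then sharedValue pp X ω j b
      else if i = maskSource pp X ω j b ∧ ∃ i < j, Member pp X ω i j b then ω.delta p j j b
      else ω.delta d j i b
    else ω.delta d j i b
  pad j b :=
    if Hidden pp X C p ω j b ∧ cuckooTable pp X ω j b = none then ω.delta p j j b else ω.pad j b
  pmt i j b := ω.pmt i j b + if i ∉ C ∧ Member pp X ω i j b then 1 else 0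
  rot j i b e := ω.rot j i b e +
    if e = rotSource C i j ∧ ¬ Finset.Icc (min 1 i) j ⊆ C ∧ Member pp X ω i j b then
      maskSum ω j i b
    else 0
  perm := ω.perm
  share := ω.share

theorem not_mem_of_rotSource {i j e : s.Party}
    (h : e = rotSource C i j ∧ ¬ Finset.Icc (min 1 i) j ⊆ C ∧ Member pp X ω i j b) : e ∉ C := by
  rw [h.1]
  exact (rotSource_spec h.2.1).2

open Classical in
theorem hybridCoins_pmt (i j : s.Party) (b : s.Bin) : (hybridCoins pp X C p ω).pmt i j b =
    ω.pmt i j b + if i ∉ C ∧ Member pp X ω i j b then 1 else 0 := rfl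

open Classical in
theorem hybridCoins_rot (i j e : s.Party) (b : s.Bin) : (hybridCoins pp X C p ω).rot j i b e =
    ω.rot j i b e + if e = rotSource C i j ∧ ¬ Finset.Icc (min 1 i) j ⊆ C ∧ Member pp X ω i j b then
      maskSum ω j i b else 0 := rfl

theorem hybridCoins_rot_of_mem {i j e : s.Party} {b : s.Bin} (he : e ∈ C) :
    (hybridCoins pp X C p ω).rot j i b e = ω.rot j i b e := by
  rw [hybridCoins_rot, if_neg fun h => not_mem_of_rotSource h he, add_zero]

theorem hybridCoins_delta_of_not_hidden {d j i : s.Party} {b : s.Bin}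
    (h : ¬ (d = p ∧ Hidden pp X C p ω j b)) :
    (hybridCoins pp X C p ω).delta d j i b = ω.delta d j i b := by
  simp only [hybridCoins]
  rw [if_neg h]

theorem maskSum_hybridCoins {j i : s.Party} {b : s.Bin} (h : ¬ Hidden pp X C p ω j b) :
    maskSum (hybridCoins pp X C p ω) j i b = maskSum ω j i b :=
  Finset.sum_congr rfl fun _ _ => hybridCoins_delta_of_not_hidden fun h' => h h'.2

theorem hybridVec_hybridCoins (h0 : 0 ∈ C) (q : s.Pos) :
    hybridVec pp X C p (hybridCoins pp X C p ω) q = sharedValue pp X ω q.1 q.2 := by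
  obtain ⟨⟨j, hj⟩, b⟩ := q
  have hH : Hidden pp X C p (hybridCoins pp X C p ω) = Hidden pp X C p ω := hidden_congr rfl
  rw [hybridVec, hH]
  by_cases h : Hidden pp X C p ω j b
  · rw [if_pos h]
    simp [hybridCoins, h]
  · rw [if_neg h]
    refine sharedValue_congr rfl (fun i _ _ => maskSum_hybridCoins h) fun hn => ?_
    have hjC : j ∈ C := by
      by_contra hjC
      exact h ⟨h0, Or.inl ⟨hjC, hn⟩⟩
    refine ⟨?_, fun i _ => hybridCoins_rot_of_mem hjC⟩
    simp only [hybridCoins]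
    rw [if_neg fun h' => h h'.1]

theorem view_eq_viewWith (hp : p ∉ C) {c : s.Party} (hc : c ∈ C) :
    view pp X ω c = viewWith pp X C (hybridCoins pp X C p ω)
      (hybridVec pp X C p (hybridCoins pp X C p ω)) c := by
  have hcp : c ≠ p := fun h => hp (h ▸ hc)
  have hM : Member pp X (hybridCoins pp X C p ω) = Member pp X ω := member_congr rfl
  have hshare : c = 0 → ∀ i q, shuffleOut pp X ω i q = simShare (hybridCoins pp X C p ω)
      (hybridVec pp X C p (hybridCoins pp X C p ω)) i q := by
    rintro rfl i q
    rw [shuffleOut, shuffle, simShare]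
    split_ifs with hi
    · rw [hybridVec_hybridCoins hc, sum_shareOut]
      rfl
    · rfl
  funext v
  cases v with
  | input t a => rfl
  | cuckoo a => rfl
  | delta j i b a =>
    simp only [view, viewWith]
    rw [hybridCoins_delta_of_not_hidden fun h => hcp h.1]
  | pad b a =>
    simp only [view, viewWith, hybridCoins]
    rw [if_neg]
    rintro ⟨⟨-, ⟨h, -⟩ | ⟨-, i, -, hm⟩⟩, hn⟩
    · exact h hc
    · exact not_member_of_none hn hm
  | pmt k b =>
    simp only [view, viewWith, simPmt, hM]
    rcases lt_trichotomy c k with h | rfl | h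
    · rw [pmtOut_lt h, if_pos h, hybridCoins_pmt]
      simp [hc]
    · simp [pmtOut]
    · rw [pmtOut_gt h, if_neg h.not_gt, if_pos h, hybridCoins_pmt]
      by_cases hk : k ∈ C <;> by_cases hm : Member pp X ω k c b <;> simp [hk, hm, hM]
  | rot j i b a =>
    simp only [view, viewWith]
    refine congrFun ?_ a
    by_cases hij : i < j
    · rw [rotOut_eq hij, simRot, if_pos hij, hM]
      by_cases hcf : c = min 1 i
      · rw [if_pos hcf, if_pos hcf]
        by_cases hQ : Finset.Icc (min 1 i) j ⊆ C
        · have h1 : ∑ e ∈ (Finset.Icc (min 1 i) j).erase (min 1 i),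
              (hybridCoins pp X C p ω).rot j i b e =
              ∑ e ∈ (Finset.Icc (min 1 i) j).erase (min 1 i), ω.rot j i b e :=
            Finset.sum_congr rfl fun e he =>
              hybridCoins_rot_of_mem (hQ (Finset.mem_of_mem_erase he))
          have h2 : maskSum (hybridCoins pp X C p ω) j i b = maskSum ω j i b := by
            refine Finset.sum_congr rfl fun d hd => ?_
            refine hybridCoins_delta_of_not_hidden fun h => ?_
            have hd' : d ≠ 0 ∧ d ≤ j := by simpa using hd
            have h3 : (1 : s.Party) ≤ d := Fin.one_le_of_ne_zero hd'.1
            exact hp (h.1 ▸ hQ (Finset.mem_Icc.2 ⟨(min_le_left _ _).trans h3, hd'.2⟩))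
          rw [h1, h2]
          by_cases hm : Member pp X ω i j b <;> simp [hQ, hm]
        · obtain ⟨he, heC⟩ := rotSource_spec hQ
          have he' : rotSource C i j ∈ (Finset.Icc (min 1 i) j).erase (min 1 i) :=
            Finset.mem_erase.2 ⟨fun h => heC (h ▸ hcf ▸ hc), he⟩
          rw [if_neg (fun h => hQ h.1 : ¬ (Finset.Icc (min 1 i) j ⊆ C ∧ _)), add_zero]
          simp only [hybridCoins_rot, Finset.sum_add_distrib]
          congr 1
          rw [Finset.sum_eq_single_of_mem _ he' fun e _ he => if_neg fun h => he h.1]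
          by_cases hm : Member pp X ω i j b <;> simp [hQ, hm]
      · rw [if_neg hcf, if_neg hcf, hybridCoins_rot_of_mem hc]
    · rw [rotOut, if_neg hij, simRot, if_neg hij]
  | shuffled q a =>
    simp only [view, viewWith]
    by_cases h : c = 0
    · rw [hshare h]
    · simp [shuffleOut, shuffle, simShare, h, hybridCoins]
  | message k q a =>
    simp only [view, viewWith]
    split_ifs with h
    · rw [hshare h]
    · rfl

theorem hybridCoins_injective (hp : p ∉ C) :
    Function.Injective (hybridCoins pp X C p) := by
  classical
  intro ω ω' h
  have hc : ω'.cuckoo = ω.cuckoo := (congrArg Coins.cuckoo h).symm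
  have hT := cuckooTable_congr (pp := pp) (X := X) hc
  have hM := member_congr (pp := pp) (X := X) hc
  have hH := hidden_congr (pp := pp) (X := X) (C := C) (p := p) hc
  have hS : maskSource pp X ω' = maskSource pp X ω := by
    unfold maskSource
    rw [hM]
  have hdelta' : ∀ d j i b, (hybridCoins pp X C p ω).delta d j i b =
      (hybridCoins pp X C p ω').delta d j i b := fun d j i b => by rw [h]
  have hpad' : ∀ j b, (hybridCoins pp X C p ω).pad j b =
      (hybridCoins pp X C p ω').pad j b := fun j b => by rw [h]
  have hrot' : ∀ j i b e, (hybridCoins pp X C p ω).rot j i b e =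
      (hybridCoins pp X C p ω').rot j i b e := fun j i b e => by rw [h]
  have hpmt' : ∀ i j b, (hybridCoins pp X C p ω).pmt i j b =
      (hybridCoins pp X C p ω').pmt i j b := fun i j b => by rw [h]
  simp only [hybridCoins, hT, hM, hH, hS] at hdelta' hpad' hrot' hpmt'
  have hval : ∀ j b, Hidden pp X C p ω j b → sharedValue pp X ω j b = sharedValue pp X ω' j b := by
    intro j b hh
    simpa [hh] using hdelta' p j j b
  have hdelta : ∀ d j i b, ω'.delta d j i b = ω.delta d j i b := by
    intro d j i b
    by_cases hd : d = p ∧ Hidden pp X C p ω j b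
    swap
    · simpa [hd] using (hdelta' d j i b).symm
    obtain ⟨rfl, hh⟩ := hd
    by_cases hm : ∃ i < j, Member pp X ω i j b
    · obtain ⟨hlt, hmem⟩ := maskSource_spec hm
      have hfill : ω.delta d j j b = ω'.delta d j j b := by
        have := hdelta' d j (maskSource pp X ω j b) b
        simpa [hh, hlt.ne, hm] using this
      have hother : ∀ i, i ≠ j → i ≠ maskSource pp X ω j b →
          ω'.delta d j i b = ω.delta d j i b := by
        intro i h1 h2
        have := hdelta' d j i b
        simpa [hh, h1, h2] using this.symm
      by_cases hij : i = j
      · rw [hij, hfill]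
      by_cases hi : i = maskSource pp X ω j b
      swap
      · exact hother i hij hi
      have hdj : d ≤ j := by
        rcases hh.2 with ⟨-, hn⟩ | ⟨hd, -⟩
        · exact absurd hmem (not_member_of_none hn)
        · exact not_lt.1 hd
      have hd0 : d ≠ 0 := fun h0 => hp (h0 ▸ hh.1)
      have hsub := sharedValue_sub_of_delta (ω' := ω') hc hlt hd0 hdj hmem (by
        intro e i' hi' hne
        by_cases hed : e = d
        · subst hed
          exact hother i' hi'.ne fun h => hne ⟨rfl, h⟩
        · have := hdelta' e j i' b
          simpa [hed] using this.symm)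
      rw [hval j b hh, sub_self] at hsub
      rw [hi]
      exact (sub_eq_zero.1 hsub.symm)
    · have hn : cuckooTable pp X ω j b = none := by
        rcases hh.2 with ⟨-, hn⟩ | ⟨-, hm'⟩
        · exact hn
        · exact absurd hm' hm
      by_cases hij : i = j
      · have := hpad' j b
        rw [if_pos ⟨hh, hn⟩, if_pos ⟨hh, hn⟩] at this
        rw [hij, this]
      · have := hdelta' d j i b
        simpa [hh, hij, hm] using this.symm
  have hmask : ∀ j i b, maskSum ω' j i b = maskSum ω j i b := fun j i b =>
    Finset.sum_congr rfl fun d _ => hdelta d j i b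
  have hrot : ∀ j i b e, ω'.rot j i b e = ω.rot j i b e := by
    intro j i b e
    have := hrot' j i b e
    rw [hmask] at this
    exact (add_right_cancel this).symm
  have hpad : ∀ j b, ω'.pad j b = ω.pad j b := by
    intro j b
    by_cases hh : Hidden pp X C p ω j b ∧ cuckooTable pp X ω j b = none
    · have := hval j b hh.1
      rw [sharedValue_none hh.2, sharedValue_none (by rw [hT, hh.2])] at this
      simp only [hrot] at this
      exact (add_left_cancel this).symm
    · have := hpad' j b
      rw [if_neg hh, if_neg hh] at this
      exact this.symm
  have hpmt : ∀ i j b, ω'.pmt i j b = ω.pmt i j b := fun i j b =>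
    (add_right_cancel (hpmt' i j b)).symm
  have hperm : ω'.perm = ω.perm := (congrArg Coins.perm h).symm
  have hshare : ω'.share = ω.share := (congrArg Coins.share h).symm
  cases ω
  cases ω'
  simp only [Coins.mk.injEq]
  refine ⟨hc.symm, ?_, ?_, ?_, ?_, hperm.symm, hshare.symm⟩
  · funext d j i b
    exact (hdelta d j i b).symm
  · funext j b
    exact (hpad j b).symm
  · funext i j b
    exact (hpmt i j b).symm
  · funext j i b e
    exact (hrot j i b e).symm

end Simulation

/-! ### Rearranging a family -/

namespace Multiset

variable {α β : Type*}

theorem filterMap_ite (P : α → Prop) [DecidablePred P] (g : α → β) (m : Multiset α) :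
    m.filterMap (fun a => if P a then some (g a) else none) = (m.filter P).map g := by
  induction m using Multiset.induction_on with
  | empty => simp
  | cons a m ih =>
    by_cases h : P a
    · rw [filterMap_cons_some _ _ _ (by rw [if_pos h]), ih, filter_cons_of_pos _ h, map_cons]
    · rw [filterMap_cons_none _ _ (by rw [if_neg h]), ih, filter_cons_of_neg _ h]

theorem exists_eq_map_some_add (m : Multiset (Option α)) :
    ∃ k, m = (m.filterMap id).map some + replicate k none := by
  induction m using Multiset.induction_on with
  | empty => exact ⟨0, by simp⟩
  | cons a m ih =>
    obtain ⟨k, hk⟩ := ih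
    cases a with
    | none =>
      refine ⟨k + 1, ?_⟩
      rw [filterMap_cons_none _ _ rfl, replicate_succ, add_cons, ← hk]
    | some a =>
      refine ⟨k, ?_⟩
      rw [filterMap_cons_some _ _ _ (show id (some a) = some a from rfl), map_cons, cons_add, ← hk]

theorem eq_of_filterMap_eq {m m' : Multiset (Option α)} (h : m.filterMap id = m'.filterMap id)
    (hc : card m = card m') : m = m' := by
  obtain ⟨k, hk⟩ := exists_eq_map_some_add m
  obtain ⟨k', hk'⟩ := exists_eq_map_some_add m'
  rw [hk, hk', h] at hc
  simp only [card_add, card_map, card_replicate, Nat.add_left_cancel_iff] at hc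
  rw [hk, hk', h, hc]

end Multiset

/-- Two families with the same values, counted with multiplicity, are rearrangements of each
other. -/
theorem exists_perm_of_map_eq {α β : Type*} [Fintype α] {f g : α → β}
    (h : (Finset.univ : Finset α).val.map f = (Finset.univ : Finset α).val.map g) :
    ∃ σ : Equiv.Perm α, ∀ q, g (σ q) = f q := by
  classical
  have hcard : ∀ y, Nonempty ({q // f q = y} ≃ {q // g q = y}) := by
    intro y
    have hy := congrArg (Multiset.count y) h
    rw [Multiset.count_map, Multiset.count_map] at hy
    refine ⟨Fintype.equivOfCardEq ?_⟩
    rw [Fintype.card_subtype, Fintype.card_subtype]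
    simpa [Finset.card, Finset.filter, eq_comm] using hy
  let e := fun y => (hcard y).some
  refine ⟨(Equiv.sigmaFiberEquiv f).symm.trans ((Equiv.sigmaCongrRight e).trans
    (Equiv.sigmaFiberEquiv g)), fun q => ?_⟩
  exact (e (f q) ⟨q, rfl⟩).2

theorem List.filterMap_getElem?_finRange {α : Type*} : ∀ (K : ℕ) (l : List α), l.length ≤ K →
    (List.finRange K).filterMap (fun r => l[r.val]?) = l
  | 0, l, h => by
    have : l = [] := List.length_eq_zero_iff.1 (by omega)
    simp [this]
  | K + 1, [], _ => by simp
  | K + 1, a :: l, h => by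
    rw [List.finRange_succ, List.filterMap_cons_some (b := a) (by simp), List.filterMap_map]
    congr 1
    exact List.filterMap_getElem?_finRange K l (by simpa using h)

theorem List.filterMap_ite_getD_finRange {α β : Type*} (K : ℕ) (l : List α) (h : l.length ≤ K)
    (P : α → Prop) [DecidablePred P] (g : α → β) (z : α)
    [∀ r : Fin K, Decidable (r.val < l.length ∧ P (l.getD r.val z))] :
    (List.finRange K).filterMap (fun r : Fin K =>
      if r.val < l.length ∧ P (l.getD r.val z) then some (g (l.getD r.val z)) else none) =
      (l.filter fun a => decide (P a)).map g := by
  have h1 : (fun r : Fin K =>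
      if r.val < l.length ∧ P (l.getD r.val z) then some (g (l.getD r.val z)) else none) =
      fun r : Fin K => (l[r.val]?).bind fun a => if P a then some (g a) else none := by
    funext r
    by_cases hr : r.val < l.length
    · simp [hr]
    · simp [hr]
  rw [h1, ← List.filterMap_filterMap, List.filterMap_getElem?_finRange K l h]
  clear h1 h
  induction l with
  | nil => rfl
  | cons a l ih => by_cases ha : P a <;> simp [ha, ih]

theorem card_unionOf_le {s : Sizes} {X : s.Party → s.Input} : (unionOf X).card ≤ s.m * s.n := by
  refine (Finset.card_biUnion_le_card_mul _ _ s.n fun j _ => ?_).trans (by simp)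
  exact Finset.card_image_le.trans (by simp)

section Simulation

variable {s : Sizes} [NeZero s.m] {pp : PublicFunctions s} {X : s.Party → s.Input}
  {C : Finset s.Party} {p : s.Party} {ω ω' : Coins s}

open Classical in
/-- An element of the union that no party before `p` has occurs exactly once unmasked in the Cuckoo
tables from `p` on, namely in the table of the first party that has it. -/
theorem map_content_not_masked (hω : CuckooSucceeds pp X ω)
    (hX : ∀ j, Function.Injective (X j)) (h0 : p ≠ 0) :
    ((Finset.univ.filter fun q : s.Pos => ¬ q.1.1 < p ∧ ¬ Masked pp X ω q.1 q.2).val.map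
      fun q => ((cuckooTable pp X ω q.1 q.2).getD (0, 0)).1) =
      ((unionOf X).filter fun x => ∀ j < p, x ∉ elems (X j)).val := by
  set R := Finset.univ.filter fun q : s.Pos => ¬ q.1.1 < p ∧ ¬ Masked pp X ω q.1 q.2 with hR
  have hmem : ∀ q ∈ R, ¬ q.1.1 < p ∧ ∃ it, cuckooTable pp X ω q.1 q.2 = some it ∧
      ∀ i < q.1.1, it.1 ∉ elems (X i) := by
    intro q hq
    obtain ⟨h1, h2⟩ := (Finset.mem_filter.1 hq).2
    obtain ⟨it, hit, -⟩ := sharedValue_of_not_masked h2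
    exact ⟨h1, it, hit, fun i hi hx => h2 (Or.inr ⟨i, hi, (member_iff hω q.1.2 hit).2 hx⟩)⟩
  have hinj : Set.InjOn (fun q : s.Pos => ((cuckooTable pp X ω q.1 q.2).getD (0, 0)).1) R := by
    rintro ⟨⟨j, hj⟩, b⟩ hq ⟨⟨j', hj'⟩, b'⟩ hq' h
    obtain ⟨-, it, hit, hlt⟩ := hmem _ hq
    obtain ⟨-, it', hit', hlt'⟩ := hmem _ hq'
    simp only [hit, hit', Option.getD_some] at h
    dsimp only at hit hit' hlt hlt'
    rcases lt_trichotomy j j' with hjj | rfl | hjj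
    · exact absurd (h ▸ mem_elems_of_cuckooTable hit) (hlt' j hjj)
    · rw [cuckooTable_bin_unique hω (hX j) hj hit hit' h]
    · exact absurd (h ▸ mem_elems_of_cuckooTable hit') (hlt j' hjj)
  rw [← Finset.image_val_of_injOn hinj]
  congr 1
  ext x
  simp only [Finset.mem_image, Finset.mem_filter]
  constructor
  · rintro ⟨q, hq, rfl⟩
    obtain ⟨h1, it, hit, hlt⟩ := hmem q hq
    simp only [hit, Option.getD_some]
    exact ⟨mem_unionOf.2 ⟨_, mem_elems_of_cuckooTable hit⟩,
      fun j hj => hlt j (hj.trans_le (not_lt.1 h1))⟩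
  · rintro ⟨hx, hpre⟩
    obtain ⟨j, hj, hlt⟩ := exists_first hx
    have hjp : ¬ j < p := fun h => hpre j h hj
    have hj0 : j ≠ 0 := by
      rintro rfl
      exact hjp (Fin.pos_iff_ne_zero.2 h0)
    obtain ⟨b, it, hit, rfl, hm⟩ := exists_not_masked hω hj0 hj hlt
    refine ⟨(⟨j, hj0⟩, b), Finset.mem_filter.2 ⟨Finset.mem_univ _, hjp, hm⟩, ?_⟩
    simp [hit]

/-- The simulator knows the entries of the shared vector that are not hidden, up to their order. -/
theorem coe_simList (hω : CuckooSucceeds pp X ω) (hX : ∀ j, Function.Injective (X j))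
    (h0 : 0 ∈ C) (hp : p ∉ C) (hmin : ∀ j < p, j ∈ C) :
    (simList pp X C p ω (unionOf X) : Multiset s.Block) =
      (Finset.univ : Finset s.Pos).val.filterMap (knownValue pp X C p ω) := by
  classical
  have hp0 : p ≠ 0 := fun h => hp (h ▸ h0)
  have hknown : knownValue pp X C p ω = fun q =>
      if ¬ Hidden pp X C p ω q.1 q.2 then some (sharedValue pp X ω q.1 q.2) else none := by
    funext q
    rw [knownValue]
    split_ifs <;> rfl
  -- the list consists of the values computed from the views and the remaining part of the union
  have hlist : (simList pp X C p ω (unionOf X) : Multiset s.Block) =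
      ((Finset.univ : Finset s.Pos).filter fun q => q.1.1 < p ∨
        (q.1.1 ∈ C ∧ cuckooTable pp X ω q.1 q.2 = none)).val.map
          (fun q => sharedValue pp X ω q.1 q.2) +
      ((unionOf X).filter fun x => ∀ j < p, x ∉ elems (X j)).val.map (encodeElem pp) := by
    rw [simList, ← Multiset.filterMap_coe, Finset.coe_toList, ← Finset.univ_disjSum_univ,
      Finset.val_disjSum, Multiset.disjSum, Multiset.filterMap_add, Multiset.filterMap_map,
      Multiset.filterMap_map]
    congr 1
    · rw [Finset.filter_val, ← Multiset.filterMap_ite]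
      congr 1
    · have h := List.filterMap_ite_getD_finRange (s.m * s.n) (unionOf X).toList
        (by simpa using card_unionOf_le) (fun x => ∀ j < p, x ∉ elems (X j)) (encodeElem pp) 0
      have h' := congrArg (fun l : List s.Block => (l : Multiset s.Block)) h
      simp only [← Multiset.filterMap_coe, ← Multiset.map_coe, ← Multiset.filter_coe,
        Finset.coe_toList] at h'
      rw [Finset.filter_val, ← h']
      congr 1
  have hrest : (Finset.univ.filter fun q : s.Pos => ¬ q.1.1 < p ∧
      ¬ Masked pp X ω q.1 q.2).val.map (fun q => sharedValue pp X ω q.1 q.2) =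
      ((unionOf X).filter fun x => ∀ j < p, x ∉ elems (X j)).val.map (encodeElem pp) := by
    rw [← map_content_not_masked hω hX hp0, Multiset.map_map]
    refine Multiset.map_congr rfl fun q hq => ?_
    obtain ⟨it, hit, hv⟩ := sharedValue_of_not_masked (Finset.mem_filter.1 hq).2.2
    simp [hit, hv]
  rw [hlist, hknown, Multiset.filterMap_ite, ← hrest, ← Multiset.map_add, ← Finset.filter_val]
  congr 1
  rw [← Finset.disjUnion_val _ _ (Finset.disjoint_filter.2 ?_)]
  · congr 1
    ext q
    simp only [Finset.disjUnion_eq_union, Finset.mem_union, Finset.mem_filter, Finset.mem_univ,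
      true_and]
    simp only [Hidden, Masked, h0, true_and]
    have h1 := hmin q.1.1
    have h2 : cuckooTable pp X ω q.1 q.2 = none → ¬ ∃ i < q.1.1, Member pp X ω i q.1 q.2 := by
      rintro hn ⟨i, -, hi⟩
      exact not_member_of_none hn hi
    by_cases hlt : q.1.1 < p
    · simp [hlt, h1 hlt]
    by_cases hn : cuckooTable pp X ω q.1 q.2 = none
    · simp [hlt, hn, h2 hn]
    · simp [hlt, hn]
  · intro q _ h1 h2
    rcases h1 with h1 | h1
    · exact h2.1 h1
    · exact h2.2 (Or.inl h1.2)

theorem exists_perm_simList (hω : CuckooSucceeds pp X ω) (hX : ∀ j, Function.Injective (X j))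
    (h0 : 0 ∈ C) (hp : p ∉ C) (hmin : ∀ j < p, j ∈ C) :
    ∃ σ : Equiv.Perm s.Pos, ∀ q,
      (simList pp X C p ω (unionOf X))[(Fintype.equivFin s.Pos (σ q)).val]? =
        knownValue pp X C p ω q := by
  have hL := coe_simList hω hX h0 hp hmin
  refine exists_perm_of_map_eq
    (g := fun q => (simList pp X C p ω (unionOf X))[(Fintype.equivFin s.Pos q).val]?) ?_
  refine Multiset.eq_of_filterMap_eq ?_ (by simp)
  rw [Multiset.filterMap_map, Multiset.filterMap_map, Function.id_comp, Function.id_comp, ← hL]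
  have hlen : (simList pp X C p ω (unionOf X)).length ≤ Fintype.card s.Pos := by
    have hcard : Fintype.card s.Pos = Multiset.card (Finset.univ : Finset s.Pos).val := rfl
    rw [← Multiset.coe_card, hL, hcard]
    obtain ⟨k, hk⟩ := Multiset.exists_eq_map_some_add
      ((Finset.univ : Finset s.Pos).val.map (knownValue pp X C p ω))
    have := congrArg Multiset.card hk
    rw [Multiset.filterMap_map, Function.id_comp] at this
    simp only [Multiset.card_add, Multiset.card_map, Multiset.card_replicate] at this
    omega
  have h := List.filterMap_getElem?_finRange _ _ hlen
  have h' := congrArg (fun l : List s.Block => (l : Multiset s.Block)) h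
  simp only [← Multiset.filterMap_coe] at h'
  have he := Multiset.filterMap_map (Fintype.equivFin s.Pos)
    (fun r => (simList pp X C p ω (unionOf X))[r.val]?) (Finset.univ : Finset s.Pos).val
  rw [Multiset.map_univ_val_equiv] at he
  exact h'.symm.trans he

/-! ### From the hybrid view to the simulated view -/

open Classical in
variable (pp X C p ω) in
/-- A rearrangement of the vector that the parties share, after which its known entries are in the
order in which the simulator lists them. -/
noncomputable def sortPerm : Equiv.Perm s.Pos :=
  if h : ∃ σ : Equiv.Perm s.Pos, ∀ q,
      (simList pp X C p ω (unionOf X))[(Fintype.equivFin s.Pos (σ q)).val]? =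
        knownValue pp X C p ω q then h.choose else 1

variable (pp X C p ω) in
/-- The coins with which the simulator produces the view, as a function of the coins of the hybrid
view: the rearrangement is absorbed by the permutation of the shuffle. -/
noncomputable def simCoins : Coins s where
  cuckoo := ω.cuckoo
  delta d j i b :=
    if h : d = p ∧ i = j ∧ j ≠ 0 then
      ω.delta p ((sortPerm pp X C p ω).symm (⟨j, h.2.2⟩, b)).1
        ((sortPerm pp X C p ω).symm (⟨j, h.2.2⟩, b)).1
        ((sortPerm pp X C p ω).symm (⟨j, h.2.2⟩, b)).2
    else ω.delta d j i b
  pad := ω.pad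
  pmt := ω.pmt
  rot := ω.rot
  perm := ω.perm.trans (sortPerm pp X C p ω)
  share := ω.share

theorem simCoins_delta_of_ne {d j i : s.Party} {b : s.Bin} (h : ¬ (d = p ∧ i = j)) :
    (simCoins pp X C p ω).delta d j i b = ω.delta d j i b := by
  simp only [simCoins]
  rw [dif_neg fun h' => h ⟨h'.1, h'.2.1⟩]

theorem maskSum_simCoins {j i : s.Party} {b : s.Bin} (h : i < j) :
    maskSum (simCoins pp X C p ω) j i b = maskSum ω j i b :=
  Finset.sum_congr rfl fun _ _ => simCoins_delta_of_ne fun h' => h.ne h'.2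

theorem sharedValue_simCoins (j : s.Party) (b : s.Bin) :
    sharedValue pp X (simCoins pp X C p ω) j b = sharedValue pp X ω j b :=
  sharedValue_congr rfl (fun _ hi _ => maskSum_simCoins hi) fun _ => ⟨rfl, fun _ _ => rfl⟩

theorem knownValue_simCoins :
    knownValue pp X C p (simCoins pp X C p ω) = knownValue pp X C p ω := by
  funext q
  rw [knownValue, knownValue, sharedValue_simCoins,
    hidden_congr (ω := ω) (ω' := simCoins pp X C p ω) rfl]

theorem simList_simCoins (U : Finset s.Elem) :
    simList pp X C p (simCoins pp X C p ω) U = simList pp X C p ω U := by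
  rw [simList, simList]
  congr 1
  funext e
  rcases e with q | r
  · rw [simItem, simItem, sharedValue_simCoins,
      cuckooTable_congr (ω := ω) (ω' := simCoins pp X C p ω) rfl]
  · rfl

theorem sortPerm_simCoins : sortPerm pp X C p (simCoins pp X C p ω) = sortPerm pp X C p ω := by
  rw [sortPerm, sortPerm]
  simp only [simList_simCoins, knownValue_simCoins]

theorem simVec_simCoins (hω : CuckooSucceeds pp X ω) (hX : ∀ j, Function.Injective (X j))
    (h0 : 0 ∈ C) (hp : p ∉ C) (hmin : ∀ j < p, j ∈ C) (q : s.Pos) :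
    simVec pp X C p (simCoins pp X C p ω) (unionOf X) (sortPerm pp X C p ω q) =
      hybridVec pp X C p ω q := by
  have hσ := exists_perm_simList hω hX h0 hp hmin
  have hσ' : (simList pp X C p ω (unionOf X))[
      (Fintype.equivFin s.Pos (sortPerm pp X C p ω q)).val]? = knownValue pp X C p ω q := by
    rw [sortPerm, dif_pos hσ]
    exact hσ.choose_spec q
  rw [simVec, simList_simCoins, hσ', knownValue, hybridVec]
  split_ifs with h
  · have h0 := (sortPerm pp X C p ω q).1.2
    simp [simCoins, h0]
  · rfl

theorem viewWith_simCoins (hω : CuckooSucceeds pp X ω) (hX : ∀ j, Function.Injective (X j))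
    (hp : p ∉ C) (hmin : ∀ j < p, j ∈ C) {c : s.Party} (hc : c ∈ C) :
    viewWith pp X C (simCoins pp X C p ω)
      (simVec pp X C p (simCoins pp X C p ω) (if 0 ∈ C then unionOf X else ∅)) c =
      viewWith pp X C ω (hybridVec pp X C p ω) c := by
  have hcp : c ≠ p := fun h => hp (h ▸ hc)
  have hshare : c = 0 → ∀ i q, simShare (simCoins pp X C p ω)
      (simVec pp X C p (simCoins pp X C p ω) (if 0 ∈ C then unionOf X else ∅)) i q =
      simShare ω (hybridVec pp X C p ω) i q := by
    rintro rfl i q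
    rw [simShare, simShare, if_pos hc]
    split_ifs with hi
    · congr 1
      exact simVec_simCoins hω hX hc hp hmin (ω.perm q)
    · rfl
  funext v
  cases v with
  | input t a => rfl
  | cuckoo a => rfl
  | delta j i b a =>
    simp only [viewWith]
    rw [simCoins_delta_of_ne fun h => hcp h.1]
  | pad b a => rfl
  | pmt k b => rfl
  | rot j i b a =>
    have hM : Member pp X (simCoins pp X C p ω) = Member pp X ω := member_congr rfl
    simp only [viewWith]
    rw [simRot, simRot, hM]
    split_ifs with h h' h''
    · rw [maskSum_simCoins h]
      rfl
    all_goals rfl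
  | shuffled q a =>
    simp only [viewWith]
    by_cases h : c = 0
    · rw [hshare h]
    · simp [simShare, h, simCoins]
  | message k q a =>
    simp only [viewWith]
    by_cases h : c = 0
    · rw [if_pos h, if_pos h, hshare h]
    · rw [if_neg h, if_neg h]

theorem simCoins_injective : Function.Injective (simCoins pp X C p) := by
  intro ω ω' h
  have hσ : sortPerm pp X C p ω' = sortPerm pp X C p ω := by
    rw [← sortPerm_simCoins, ← h, sortPerm_simCoins]
  have hdelta : ω.delta = ω'.delta := by
    funext d j i b
    by_cases hd : d = p ∧ i = j ∧ j ≠ 0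
    · obtain ⟨rfl, rfl, hj⟩ := hd
      set r := sortPerm pp X C d ω (⟨i, hj⟩, b) with hr
      have h1 := congrArg (fun ω : Coins s => ω.delta d r.1 r.1 r.2) h
      have h2 : (sortPerm pp X C d ω).symm (⟨r.1.1, r.1.2⟩, r.2) = (⟨i, hj⟩, b) := by
        rw [Equiv.symm_apply_eq]
      simpa [simCoins, r.1.2, hσ, h2] using h1
    · have := congrArg (fun ω : Coins s => ω.delta d j i b) h
      simpa [simCoins, hd] using this
  have hperm : ω.perm = ω'.perm := by
    have := congrArg Coins.perm h
    simp only [simCoins, hσ] at this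
    ext1 q
    exact (sortPerm pp X C p ω).injective (Equiv.ext_iff.1 this q)
  have hc := congrArg Coins.cuckoo h
  have hpad := congrArg Coins.pad h
  have hpmt := congrArg Coins.pmt h
  have hrot := congrArg Coins.rot h
  have hshare := congrArg Coins.share h
  cases ω
  cases ω'
  simp only [Coins.mk.injEq]
  exact ⟨hc, hdelta, hpad, hpmt, hrot, hperm, hshare⟩

end Simulation

/-! ### Random values that look like elements with their hash values -/

section FalsePositives

variable {s : Sizes} [NeZero s.m] {pp : PublicFunctions s} {X : s.Party → s.Input} {ω ω' : Coins s}

variable (pp X ω) in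
open Classical in
/-- Shift a coin of the mask of `sharedValue pp X ω j b` and the padding for the same bin by `t`. -/
noncomputable def shiftMask (j : s.Party) (b : s.Bin) (t : s.Block) : Coins s :=
  { ω with
    delta := fun d j' i b' => ω.delta d j' i b' +
      if d = j ∧ j' = j ∧ i = maskSource pp X ω j b ∧ b' = b then t else 0
    pad := fun j' b' => ω.pad j' b' + if j' = j ∧ b' = b then t else 0 }

theorem sharedValue_shiftMask {j : s.Party} {b : s.Bin} (hj : j ≠ 0) (h : Masked pp X ω j b)
    (t : s.Block) :
    sharedValue pp X (shiftMask pp X ω j b t) j b = sharedValue pp X ω j b + t := by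
  by_cases hn : cuckooTable pp X ω j b = none
  · rw [sharedValue_none hn, sharedValue_none (ω := shiftMask pp X ω j b t) hn]
    simp [shiftMask, add_assoc]
  · obtain ⟨hlt, hm⟩ := maskSource_spec (h.resolve_left hn)
    have hsub := sharedValue_sub_of_delta (ω := ω) (ω' := shiftMask pp X ω j b t) rfl hlt hj
      le_rfl hm
      (fun d i _ hne => by simp only [shiftMask]; rw [if_neg fun h => hne ⟨h.1, h.2.2.1⟩, add_zero])
    rw [sub_eq_iff_eq_add] at hsub
    rw [hsub]
    simp [shiftMask, add_comm]

theorem shiftMask_injective (j : s.Party) (b : s.Bin) (t : s.Block) :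
    Function.Injective fun ω : Coins s => shiftMask pp X ω j b t := by
  intro ω ω' h
  have hc : ω.cuckoo = ω'.cuckoo := (congrArg Coins.cuckoo h :)
  have hS : maskSource pp X ω = maskSource pp X ω' := by
    unfold maskSource
    rw [member_congr hc]
  have hdelta : ω.delta = ω'.delta := by
    funext d j' i b'
    have := congrArg (fun ω : Coins s => ω.delta d j' i b') h
    simp only [shiftMask, hS] at this
    exact add_right_cancel this
  have hpad : ω.pad = ω'.pad := by
    funext j' b'
    have := congrArg (fun ω : Coins s => ω.pad j' b') h
    simp only [shiftMask] at this
    exact add_right_cancel this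
  have hpmt : ω.pmt = ω'.pmt := (congrArg Coins.pmt h :)
  have hrot : ω.rot = ω'.rot := (congrArg Coins.rot h :)
  have hperm : ω.perm = ω'.perm := (congrArg Coins.perm h :)
  have hshare : ω.share = ω'.share := (congrArg Coins.share h :)
  cases ω
  cases ω'
  simp only [Coins.mk.injEq]
  exact ⟨hc, hdelta, hpad, hpmt, hrot, hperm, hshare⟩

open Classical in
variable (pp X) in
/-- A masked value is a uniform string of length `l + κ`, and `2 ^ l` such strings consist of an
element and its hash value. The count goes by shifting the last `κ` bits. -/
theorem card_falsePositive_mul_le {j : s.Party} (hj : j ≠ 0) (b : s.Bin) :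
    (Finset.univ.filter fun ω : Coins s => Masked pp X ω j b ∧
      ∃ x, sharedValue pp X ω j b = encodeElem pp x).card * 2 ^ s.κ ≤ Fintype.card (Coins s) := by
  have hcard : Fintype.card (Str s.κ) = 2 ^ s.κ := by
    simp [Str, Bit, ZMod.card]
  rw [← hcard, ← Finset.card_univ (α := Str s.κ), ← Finset.card_product,
    ← Finset.card_univ (α := Coins s)]
  refine Finset.card_le_card_of_injOn
    (fun a => shiftMask pp X a.1 j b (Fin.append (0 : s.Elem) a.2))
    (fun _ _ => Finset.mem_univ _) ?_
  rintro ⟨ω, t⟩ hω ⟨ω', t'⟩ hω' h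
  simp only [Finset.coe_product, Set.mem_prod, Finset.mem_coe, Finset.mem_filter, Finset.mem_univ,
    true_and, and_true] at hω hω'
  obtain ⟨hm, x, hx⟩ := hω
  obtain ⟨hm', x', hx'⟩ := hω'
  have hv := congrArg (fun ω => sharedValue pp X ω j b) h
  simp only [sharedValue_shiftMask hj hm, sharedValue_shiftMask hj hm', hx, hx'] at hv
  obtain rfl : x = x' := by
    funext i
    have := congrFun hv (Fin.castAdd _ i)
    simpa [encodeElem] using this
  obtain rfl : t = t' := by
    funext i
    have := congrFun (add_left_cancel hv) (Fin.natAdd _ i)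
    simpa using this
  rw [show ω = ω' from shiftMask_injective j b _ h]

theorem card_pos (s : Sizes) [NeZero s.m] : Fintype.card s.Pos = (s.m - 1) * s.B := by
  simp [Fintype.card_subtype_compl]

open Classical in
variable (pp X) in
theorem card_leaderOut_ne_mul_le :
    (Finset.univ.filter fun ω : Coins s =>
      CuckooSucceeds pp X ω ∧ leaderOut pp X ω ≠ unionOf X).card * 2 ^ s.κ ≤
      (s.m - 1) * s.B * Fintype.card (Coins s) := by
  have hsub : (Finset.univ.filter fun ω : Coins s =>
      CuckooSucceeds pp X ω ∧ leaderOut pp X ω ≠ unionOf X) ⊆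
      (Finset.univ : Finset s.Pos).biUnion fun q => Finset.univ.filter fun ω : Coins s =>
        Masked pp X ω q.1 q.2 ∧ ∃ x, sharedValue pp X ω q.1 q.2 = encodeElem pp x := by
    intro ω hω
    obtain ⟨hs, hne⟩ := (Finset.mem_filter.1 hω).2
    by_contra hcon
    refine hne (leaderOut_eq_unionOf hs fun q hm x hx => hcon ?_)
    exact Finset.mem_biUnion.2 ⟨q, Finset.mem_univ _, Finset.mem_filter.2
      ⟨Finset.mem_univ _, hm, x, hx⟩⟩
  refine (Nat.mul_le_mul_right _ ((Finset.card_le_card hsub).trans Finset.card_biUnion_le)).trans ?_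
  rw [Finset.sum_mul]
  refine (Finset.sum_le_card_nsmul _ _ _ fun q _ =>
    card_falsePositive_mul_le pp X q.1.2 q.2).trans ?_
  rw [Finset.card_univ, card_pos, smul_eq_mul]

end FalsePositives

/-! ### Statistical distance -/

theorem PMF.toReal_toOuterMeasure_uniformOfFintype {Ω : Type*} [Fintype Ω] [Nonempty Ω] (E : Set Ω)
    [DecidablePred (· ∈ E)] :
    ((uniformOfFintype Ω).toOuterMeasure E).toReal =
      ((Finset.univ.filter (· ∈ E)).card : ℝ) / Fintype.card Ω := by
  rw [toOuterMeasure_uniformOfFintype_apply, ENNReal.toReal_div, ENNReal.toReal_natCast,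
    ENNReal.toReal_natCast, Fintype.card_subtype]

/-- Two events of a uniform distribution that correspond to each other under a bijection, except on
two exceptional sets, have almost the same probability. -/
theorem abs_prob_sub_prob_le {Ω : Type*} [Fintype Ω] [Nonempty Ω] {Φ : Ω → Ω}
    (hΦ : Function.Injective Φ) {E E' bad bad' : Set Ω}
    (h : ∀ ω, ω ∉ bad → ω ∉ bad' → (ω ∈ E ↔ Φ ω ∈ E')) :
    |((PMF.uniformOfFintype Ω).toOuterMeasure E).toReal -
      ((PMF.uniformOfFintype Ω).toOuterMeasure E').toReal| ≤
      ((PMF.uniformOfFintype Ω).toOuterMeasure bad).toReal +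
        ((PMF.uniformOfFintype Ω).toOuterMeasure bad').toReal := by
  classical
  simp only [PMF.toReal_toOuterMeasure_uniformOfFintype]
  have hpre : (Finset.univ.filter (· ∈ E')).card = (Finset.univ.filter fun ω => Φ ω ∈ E').card := by
    have hb : Function.Bijective Φ := Finite.injective_iff_bijective.1 hΦ
    refine (Finset.card_bij (fun ω _ => Φ ω) ?_ (fun _ _ _ _ h => hΦ h) ?_).symm
    · intro ω hω
      simpa using hω
    · intro ω hω
      obtain ⟨ω', rfl⟩ := hb.2 ω
      exact ⟨ω', by simpa using hω, rfl⟩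
  have h1 : Finset.univ.filter (· ∈ E) ⊆ (Finset.univ.filter fun ω => Φ ω ∈ E') ∪
      (Finset.univ.filter (· ∈ bad) ∪ Finset.univ.filter (· ∈ bad')) := by
    intro ω hω
    have := h ω
    simp only [Finset.mem_union, Finset.mem_filter, Finset.mem_univ, true_and] at hω ⊢
    tauto
  have h2 : (Finset.univ.filter fun ω => Φ ω ∈ E') ⊆ Finset.univ.filter (· ∈ E) ∪
      (Finset.univ.filter (· ∈ bad) ∪ Finset.univ.filter (· ∈ bad')) := by
    intro ω hω
    have := h ω
    simp only [Finset.mem_union, Finset.mem_filter, Finset.mem_univ, true_and] at hω ⊢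
    tauto
  have c1 := (Finset.card_le_card h1).trans ((Finset.card_union_le _ _).trans
    (Nat.add_le_add_left (Finset.card_union_le _ _) _))
  have c2 := (Finset.card_le_card h2).trans ((Finset.card_union_le _ _).trans
    (Nat.add_le_add_left (Finset.card_union_le _ _) _))
  rw [hpre, ← sub_div, ← add_div, abs_div, Nat.abs_cast]
  refine div_le_div_of_nonneg_right ?_ (Nat.cast_nonneg _)
  rw [abs_le]
  have c1' : ((Finset.univ.filter (· ∈ E)).card : ℝ) ≤ (Finset.univ.filter fun ω => Φ ω ∈ E').card +
    ((Finset.univ.filter (· ∈ bad)).card + (Finset.univ.filter (· ∈ bad')).card) := by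
    exact_mod_cast c1
  have c2' : ((Finset.univ.filter fun ω => Φ ω ∈ E').card : ℝ) ≤ (Finset.univ.filter (· ∈ E)).card +
    ((Finset.univ.filter (· ∈ bad)).card + (Finset.univ.filter (· ∈ bad')).card) := by
    exact_mod_cast c2
  constructor <;> linarith

/-- A simulator that outputs the simulated view for uniform coins is good enough. -/
theorem statClose_of_eval_eq {s : Sizes} [NeZero s.m] {C : Finset s.Party} {p : s.Party}
    (hp : p ∉ C) (hmin : ∀ j < p, j ∈ C) (pp : PublicFunctions s) (X : s.Party → s.Input)
    (hX : ∀ j, Function.Injective (X j)) (S : Simulator s C)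
    (hS : S.eval pp (simInput (fun c : C => X c) (if 0 ∈ C then unionOf X else ∅)) =
      (PMF.uniformOfFintype (Coins s)).map fun ω cw => viewWith pp X C ω
        (simVec pp X C p ω (if 0 ∈ C then unionOf X else ∅)) cw.1 cw.2) :
    StatClose (((s.m - 1 : ℝ) * s.B) / 2 ^ s.κ + cuckooFailure pp X)
      (realExec pp C X) (idealExec pp S X) := by
  classical
  intro A
  rw [realExec, idealExec, hS, PMF.map_comp, PMF.toOuterMeasure_map_apply,
    PMF.toOuterMeasure_map_apply]
  have hinj : Function.Injective fun ω : Coins s => simCoins pp X C p (hybridCoins pp X C p ω) :=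
    simCoins_injective.comp (hybridCoins_injective hp)
  refine (abs_prob_sub_prob_le hinj
    (bad := {ω | CuckooSucceeds pp X ω ∧ leaderOut pp X ω ≠ unionOf X})
    (bad' := {ω | ∃ j : s.Party, j ≠ 0 ∧ ¬ IsCuckoo pp (X j) (pp.place (ω.cuckoo j) (X j))})
    fun ω h1 h2 => ?_).trans ?_
  · have hω : CuckooSucceeds pp X ω := by
      intro j hj
      by_contra h
      exact h2 ⟨j, hj, h⟩
    have hout : leaderOut pp X ω = unionOf X := by
      by_contra h
      exact h1 ⟨hω, h⟩
    have hω' : CuckooSucceeds pp X (hybridCoins pp X C p ω) := hω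
    have hview : (fun cw : C × ViewWire s => view pp X ω cw.1 cw.2) = fun cw =>
        viewWith pp X C (simCoins pp X C p (hybridCoins pp X C p ω))
          (simVec pp X C p (simCoins pp X C p (hybridCoins pp X C p ω))
            (if 0 ∈ C then unionOf X else ∅)) cw.1 cw.2 := by
      funext cw
      rw [viewWith_simCoins hω' hX hp hmin cw.1.2, view_eq_viewWith hp cw.1.2]
    simp only [Set.mem_preimage, Function.comp, hview, hout]
  · refine add_le_add ?_ le_rfl
    rw [PMF.toReal_toOuterMeasure_uniformOfFintype, div_le_div_iff₀
      (by exact_mod_cast Fintype.card_pos) (by positivity)]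
    have h := card_leaderOut_ne_mul_le pp X
    have hm : ((s.m - 1 : ℕ) : ℝ) = (s.m : ℝ) - 1 := by
      rw [Nat.cast_sub (NeZero.one_le), Nat.cast_one]
    rw [← hm]
    exact_mod_cast h

/-! ### The simulator as a circuit -/

theorem BitComp.congr {s : Sizes} {D ι : Type} {pf : D → PublicFunctions s} {enc : D → ι → Bit}
    {k : ℕ} {f g : D → Bit} (h : BitComp pf enc k f) (hfg : ∀ d, g d = f d) :
    BitComp pf enc k g := by
  rwa [show g = f from funext hfg]

theorem PropComp.congr {s : Sizes} {D ι : Type} {pf : D → PublicFunctions s} {enc : D → ι → Bit}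
    {k : ℕ} {P Q : D → Prop} (h : PropComp pf enc k P) (hPQ : ∀ d, Q d ↔ P d) :
    PropComp pf enc k Q := by
  rwa [show Q = P from funext fun d => propext (hPQ d)]

namespace Sizes

variable (s : Sizes)

theorem m_le : s.m ≤ s.total := by unfold total; omega
theorem n_le : s.n ≤ s.total := by unfold total; omega
theorem ρ_le : s.ρ ≤ s.total := by unfold total; omega
theorem B_le : s.B ≤ s.total := by unfold total; omega
theorem l_le : s.l ≤ s.total := by unfold total; omega
theorem block_lt : s.l + s.κ < s.total := by unfold total; omega

theorem card_pos_le [NeZero s.m] : Fintype.card s.Pos ≤ s.total ^ 2 := by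
  rw [card_pos, pow_two]
  exact Nat.mul_le_mul ((Nat.sub_le _ _).trans s.m_le) s.B_le

end Sizes

/-- The bits of the coins other than the permutation. -/
abbrev CoinWire (s : Sizes) [NeZero s.m] : Type :=
  (s.Party × Fin s.ρ) ⊕ (s.Party × s.Party × s.Party × s.Bin × Fin (s.l + s.κ)) ⊕
    (s.Party × s.Bin × Fin (s.l + s.κ)) ⊕ (s.Party × s.Party × s.Bin) ⊕
    (s.Party × s.Party × s.Bin × s.Party × Fin (s.l + s.κ)) ⊕ (s.Party × s.Pos × Fin (s.l + s.κ))

/-- The coins consist of bits and a permutation. -/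
def coinsEquiv (s : Sizes) [NeZero s.m] : Coins s ≃ (CoinWire s → Bit) × Equiv.Perm s.Pos where
  toFun ω := (Sum.elim (fun x => ω.cuckoo x.1 x.2)
    (Sum.elim (fun x => ω.delta x.1 x.2.1 x.2.2.1 x.2.2.2.1 x.2.2.2.2)
    (Sum.elim (fun x => ω.pad x.1 x.2.1 x.2.2)
    (Sum.elim (fun x => ω.pmt x.1 x.2.1 x.2.2)
    (Sum.elim (fun x => ω.rot x.1 x.2.1 x.2.2.1 x.2.2.2.1 x.2.2.2.2)
      (fun x => ω.share x.1 x.2.1 x.2.2))))), ω.perm)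
  invFun y :=
    { cuckoo := fun c a => y.1 (.inl (c, a))
      delta := fun d j i b a => y.1 (.inr (.inl (d, j, i, b, a)))
      pad := fun j b a => y.1 (.inr (.inr (.inl (j, b, a))))
      pmt := fun i j b => y.1 (.inr (.inr (.inr (.inl (i, j, b)))))
      rot := fun j i b e a => y.1 (.inr (.inr (.inr (.inr (.inl (j, i, b, e, a))))))
      share := fun k q a => y.1 (.inr (.inr (.inr (.inr (.inr (k, q, a))))))
      perm := y.2 }
  left_inv _ := rfl
  right_inv y := by
    refine Prod.ext ?_ rfl
    funext w
    rcases w with w | w | w | w | w | w <;> rfl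

theorem card_coinWire_le (s : Sizes) [NeZero s.m] : Fintype.card (CoinWire s) ≤ s.total ^ 8 := by
  have hT := s.two_le_total
  have h1 := s.one_le_pow 1
  have hw := s.block_lt.le
  have hP := s.card_pos_le
  have e1 : s.m * s.ρ ≤ s.total ^ 5 :=
    (Nat.mul_le_mul s.m_le s.ρ_le).trans (by rw [← pow_two]; exact s.pow_le (by norm_num))
  have e2 : s.m * (s.m * (s.m * (s.B * (s.l + s.κ)))) ≤ s.total ^ 5 := by
    rw [show s.total ^ 5 = s.total * (s.total * (s.total * (s.total * s.total))) by ring]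
    gcongr <;> first | exact s.m_le | exact s.B_le
  have e3 : s.m * (s.B * (s.l + s.κ)) ≤ s.total ^ 5 := by
    refine le_trans ?_ (s.pow_le (show 3 ≤ 5 by norm_num))
    rw [show s.total ^ 3 = s.total * (s.total * s.total) by ring]
    gcongr <;> first | exact s.m_le | exact s.B_le
  have e4 : s.m * (s.m * s.B) ≤ s.total ^ 5 := by
    refine le_trans ?_ (s.pow_le (show 3 ≤ 5 by norm_num))
    rw [show s.total ^ 3 = s.total * (s.total * s.total) by ring]
    gcongr <;> first | exact s.m_le | exact s.B_le
  have e5 : s.m * (s.m * (s.B * (s.m * (s.l + s.κ)))) ≤ s.total ^ 5 := by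
    rw [show s.total ^ 5 = s.total * (s.total * (s.total * (s.total * s.total))) by ring]
    gcongr <;> first | exact s.m_le | exact s.B_le
  have e6 : s.m * (Fintype.card s.Pos * (s.l + s.κ)) ≤ s.total ^ 5 := by
    refine le_trans ?_ (s.pow_le (show 4 ≤ 5 by norm_num))
    rw [show s.total ^ 4 = s.total * (s.total ^ 2 * s.total) by ring]
    gcongr
    exact s.m_le
  have hc : Fintype.card (CoinWire s) = s.m * s.ρ +
      (s.m * (s.m * (s.m * (s.B * (s.l + s.κ)))) + (s.m * (s.B * (s.l + s.κ)) +
      (s.m * (s.m * s.B) + (s.m * (s.m * (s.B * (s.m * (s.l + s.κ)))) +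
        s.m * (Fintype.card s.Pos * (s.l + s.κ)))))) := by
    rw [Fintype.card_sum, Fintype.card_sum, Fintype.card_sum, Fintype.card_sum, Fintype.card_sum]
    simp only [Fintype.card_prod, Fintype.card_fin]
  have h : 6 * s.total ^ 5 ≤ s.total ^ 8 := s.mul_pow_le (j := 3) (by norm_num)
  rw [hc]
  omega

/-- What a simulation depends on: public functions, inputs and coins. -/
abbrev SimData (s : Sizes) [NeZero s.m] : Type :=
  PublicFunctions s × (s.Party → s.Input) × Coins s

/-- The union, if the simulator is given it. -/
def givenUnion {s : Sizes} (C : Finset s.Party) [NeZero s.m] (X : s.Party → s.Input) :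
    Finset s.Elem :=
  if 0 ∈ C then unionOf X else ∅

/-- The bits from which the simulated view is computed: random bits, and the input of the
simulator. -/
noncomputable def simEnv {s : Sizes} [NeZero s.m] (C : Finset s.Party) (d : SimData s) :
    (CoinWire s ⊕ s.Pos × s.Pos) ⊕ SimWire s C → Bit :=
  Sum.elim (Sum.elim (coinsEquiv s d.2.2).1 (permBits d.2.2.perm))
    (simInput (fun c : C => d.2.1 c) (givenUnion C d.2.1))

theorem card_filter_party_le {s : Sizes} (S : Finset s.Party) : S.card ≤ s.total ^ 1 := by
  rw [pow_one]
  exact (Finset.card_le_univ S).trans (by simpa using s.m_le)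

theorem card_entries_le {s : Sizes} [NeZero s.m] :
    (Finset.univ : Finset (Fin s.n × Fin 3)).card ≤ s.total ^ 3 := by
  have h := s.two_le_total
  simp only [Finset.card_univ, Fintype.card_prod, Fintype.card_fin]
  calc s.n * 3 ≤ s.total * s.total ^ 2 := Nat.mul_le_mul s.n_le (by nlinarith)
    _ = s.total ^ 3 := by ring

section SimCircuit

variable {s : Sizes} [NeZero s.m] {C : Finset s.Party} {p : s.Party}

/-- `BitComp` for the simulation. -/
abbrev SimBit (C : Finset s.Party) (k : ℕ) (f : SimData s → Bit) : Prop :=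
  BitComp (Prod.fst : SimData s → PublicFunctions s) (simEnv C) k f

/-- `PropComp` for the simulation. -/
abbrev SimProp (C : Finset s.Party) (k : ℕ) (P : SimData s → Prop) : Prop :=
  PropComp (Prod.fst : SimData s → PublicFunctions s) (simEnv C) k P

theorem simBit_cuckoo (c : s.Party) (a : Fin s.ρ) : SimBit C 0 fun d => d.2.2.cuckoo c a :=
  BitComp.wire (enc := simEnv C) (.inl (.inl (.inl (c, a))))

theorem simBit_delta (e j i : s.Party) (b : s.Bin) (a : Fin (s.l + s.κ)) :
    SimBit C 0 fun d => d.2.2.delta e j i b a :=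
  BitComp.wire (enc := simEnv C) (.inl (.inl (.inr (.inl (e, j, i, b, a)))))

theorem simBit_pad (j : s.Party) (b : s.Bin) (a : Fin (s.l + s.κ)) :
    SimBit C 0 fun d => d.2.2.pad j b a :=
  BitComp.wire (enc := simEnv C) (.inl (.inl (.inr (.inr (.inl (j, b, a))))))

theorem simBit_pmt (i j : s.Party) (b : s.Bin) : SimBit C 0 fun d => d.2.2.pmt i j b :=
  BitComp.wire (enc := simEnv C) (.inl (.inl (.inr (.inr (.inr (.inl (i, j, b)))))))

theorem simBit_rot (j i : s.Party) (b : s.Bin) (e : s.Party) (a : Fin (s.l + s.κ)) :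
    SimBit C 0 fun d => d.2.2.rot j i b e a :=
  BitComp.wire (enc := simEnv C) (.inl (.inl (.inr (.inr (.inr (.inr (.inl (j, i, b, e, a))))))))

theorem simBit_share (k : s.Party) (q : s.Pos) (a : Fin (s.l + s.κ)) :
    SimBit C 0 fun d => d.2.2.share k q a :=
  BitComp.wire (enc := simEnv C) (.inl (.inl (.inr (.inr (.inr (.inr (.inr (k, q, a))))))))

theorem simProp_perm (q r : s.Pos) : SimProp C 0 fun d => d.2.2.perm q = r := by
  have h := BitComp.wire (pf := (Prod.fst : SimData s → PublicFunctions s)) (enc := simEnv C)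
    (.inl (.inr (q, r)))
  refine BitComp.congr h fun d => ?_
  simp only [simEnv, permBits, Sum.elim_inl, Sum.elim_inr]
  split_ifs <;> rfl

theorem simBit_input {c : s.Party} (hc : c ∈ C) (t : Fin s.n) (a : Fin s.l) :
    SimBit C 0 fun d => d.2.1 c t a :=
  BitComp.wire (enc := simEnv C) (.inr (.input ⟨c, hc⟩ t a))

theorem simProp_used (q : Fin (s.m * s.n)) :
    SimProp C 0 fun d => q.val < (givenUnion C d.2.1).toList.length := by
  have h := BitComp.wire (pf := (Prod.fst : SimData s → PublicFunctions s)) (enc := simEnv C)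
    (.inr (.used q))
  refine BitComp.congr h fun d => ?_
  simp only [simEnv, simInput, Sum.elim_inr]
  split_ifs <;> rfl

theorem simBit_slot (q : Fin (s.m * s.n)) (a : Fin s.l) :
    SimBit C 0 fun d => ((givenUnion C d.2.1).toList.getD q.val 0) a :=
  BitComp.wire (enc := simEnv C) (.inr (.slot q a))

theorem simProp_place {j : s.Party} (hj : j ∈ C) (b : s.Bin) (tk : Fin s.n × Fin 3) :
    SimProp C 4 fun d => d.1.place (d.2.2.cuckoo j) (d.2.1 j) b = some tk :=
  PropComp.place (simBit_cuckoo j) (simBit_input hj) b tk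

theorem simProp_member {i j : s.Party} (hi : i ∈ C) (hj : j ∈ C) (b : s.Bin) :
    SimProp C 36 fun d => Member d.1 d.2.1 d.2.2 i j b := by
  have h1 : ∀ tk : Fin s.n × Fin 3, SimProp C 20 fun d =>
      ∃ t ∈ (Finset.univ : Finset (Fin s.n)), d.2.1 i t = d.2.1 j tk.1 := fun tk =>
    PropComp.ex (a := 1) (k := 10) Finset.univ (fun t _ => PropComp.eq_str (k := 0) s.l_le
      (simBit_input hi t) (simBit_input hj tk.1)) (by simpa using s.n_le)
  have h2 := PropComp.ex (a := 3) (k := 24) Finset.univ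
    (fun tk _ => (simProp_place hj b tk |>.mono (by norm_num)).and
      (((PropComp.bin (simBit_input hj tk.1) tk.2 b).mono (by norm_num)).and (h1 tk)))
    card_entries_le
  refine h2.congr fun d => ?_
  constructor
  · rintro ⟨it, hit, h⟩
    obtain ⟨t, ht, htx⟩ := cuckooTable_eq_some.1 h
    obtain ⟨hx, hb⟩ := mem_simpleTable.1 hit
    obtain ⟨t', -, ht'⟩ := Finset.mem_image.1 hx
    refine ⟨(t, it.2), Finset.mem_univ _, ht, ?_, t', Finset.mem_univ _, ?_⟩
    · rw [htx, hb]
    · rw [htx, ht']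
  · rintro ⟨⟨t, k⟩, -, ht, hb, t', -, ht'⟩
    refine ⟨(d.2.1 j t, k), mem_simpleTable.2 ⟨?_, hb⟩, cuckooTable_eq_some.2 ⟨t, ht, rfl⟩⟩
    exact Finset.mem_image.2 ⟨t', Finset.mem_univ _, ht'⟩

theorem simProp_table_none {j : s.Party} (hj : j ∈ C) (b : s.Bin) :
    SimProp C 19 fun d => cuckooTable d.1 d.2.1 d.2.2 j b = none := by
  have h := (PropComp.ex (a := 3) Finset.univ (fun tk _ => simProp_place hj b tk)
    card_entries_le).not
  refine h.congr fun d => ?_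
  cases hp : d.1.place (d.2.2.cuckoo j) (d.2.1 j) b <;> simp [cuckooTable, hp]

theorem simBit_content {j : s.Party} (hj : j ∈ C) (b : s.Bin) (a : Fin s.l) :
    SimBit C 19 fun d => ((cuckooTable d.1 d.2.1 d.2.2 j b).getD (0, 0)).1 a := by
  classical
  have h := BitComp.sum (a := 3) (k := 12) Finset.univ (fun (tk : Fin s.n × Fin 3) _ =>
    BitComp.ite (simProp_place hj b tk) ((simBit_input hj tk.1 a).mono (by norm_num))
      (BitComp.zero.mono (by norm_num))) card_entries_le
  refine h.congr fun d => ?_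
  cases hp : d.1.place (d.2.2.cuckoo j) (d.2.1 j) b with
  | none => simp [cuckooTable, hp]
  | some tk => simp [cuckooTable, hp]

theorem simBit_encodeElem {k : ℕ} {x : SimData s → s.Elem} (hx : ∀ a, SimBit C k fun d => x d a)
    (a : Fin (s.l + s.κ)) : SimBit C (k + 2) fun d => encodeElem d.1 (x d) a := by
  refine Fin.addCases (fun a => ?_) (fun a => ?_) a
  · exact ((hx a).mono (by omega)).congr fun d => by simp [encodeElem]
  · exact (BitComp.hash hx a).congr fun d => by simp [encodeElem]

theorem simBit_maskSum (j i : s.Party) (b : s.Bin) (a : Fin (s.l + s.κ)) :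
    SimBit C 5 fun d => maskSum d.2.2 j i b a :=
  (BitComp.sum (a := 1) _ (fun e _ => simBit_delta e j i b a) (card_filter_party_le _)).congr
    fun d => by rw [maskSum, Finset.sum_apply]

theorem simBit_rot_pad (j : s.Party) (b : s.Bin) (a : Fin (s.l + s.κ)) :
    SimBit C 8 fun d => (∑ i ∈ Finset.univ.filter (· < j), d.2.2.rot j i b j + d.2.2.pad j b) a :=
  ((BitComp.sum (a := 1) _ (fun i _ => simBit_rot j i b j a) (card_filter_party_le _)).add
    ((simBit_pad j b a).mono (by norm_num))).congr
      fun d => by rw [Pi.add_apply, Finset.sum_apply]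

theorem simBit_sharedValue {j : s.Party} (h : ∀ i ≤ j, i ∈ C) (b : s.Bin) (a : Fin (s.l + s.κ)) :
    SimBit C 60 fun d => sharedValue d.1 d.2.1 d.2.2 j b a := by
  classical
  have hj := h j le_rfl
  have h1 : SimBit C 49 fun d => ∑ i ∈ Finset.univ.filter (· < j),
      if Member d.1 d.2.1 d.2.2 i j b then maskSum d.2.2 j i b a else 0 :=
    BitComp.sum (a := 1) (k := 44) _ (fun i hi => BitComp.ite
      (simProp_member (h i (Finset.mem_filter.1 hi).2.le) hj b)
      ((simBit_maskSum j i b a).mono (by norm_num)) (BitComp.zero.mono (by norm_num)))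
      (card_filter_party_le _)
  have h2 := ((simBit_encodeElem (simBit_content hj b) a).mono (b := 49) (by norm_num)).add h1
  refine (BitComp.ite ((simProp_table_none hj b).mono (by norm_num))
    ((simBit_rot_pad j b a).mono (by norm_num)) h2).congr fun d => ?_
  cases hd : cuckooTable d.1 d.2.1 d.2.2 j b with
  | none => rw [sharedValue_none hd, if_pos rfl]
  | some it =>
    rw [sharedValue_some hd, if_neg (by simp), Pi.add_apply, Finset.sum_apply]
    congr 1
    refine Finset.sum_congr rfl fun i _ => ?_
    split_ifs <;> rfl

theorem simProp_simItem (hmin : ∀ j < p, j ∈ C) (e : s.Pos ⊕ Fin (s.m * s.n)) :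
    SimProp C 70 fun d => (simItem d.1 d.2.1 C p d.2.2 (givenUnion C d.2.1) e).isSome := by
  classical
  rcases e with ⟨j, b⟩ | r
  · by_cases hp : j.1 < p
    · exact ((PropComp.const True).mono (by norm_num)).congr fun d => by simp [simItem, hp]
    by_cases hj : j.1 ∈ C
    · refine ((simProp_table_none hj b).mono (by norm_num)).congr fun d => ?_
      by_cases hd : cuckooTable d.1 d.2.1 d.2.2 j b = none <;> simp [simItem, hp, hj, hd]
    · exact ((PropComp.const False).mono (by norm_num)).congr fun d => by simp [simItem, hp, hj]
  · have h1 : SimProp C 27 fun d => ∀ j ∈ Finset.univ.filter (· < p),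
        ¬ ∃ t ∈ (Finset.univ : Finset (Fin s.n)),
          d.2.1 j t = (givenUnion C d.2.1).toList.getD r.val 0 :=
      PropComp.all (a := 1) (k := 23) _ (fun j hj => (PropComp.ex (a := 1) (k := 10) Finset.univ
        (fun t _ => PropComp.eq_str (k := 0) s.l_le
          (simBit_input (hmin j (Finset.mem_filter.1 hj).2) t) (simBit_slot r))
        (by simpa using s.n_le)).not) (card_filter_party_le _)
    refine ((((simProp_used r).mono (by norm_num)).and h1).mono (by norm_num)).congr fun d => ?_
    rw [simItem]
    split_ifs with h <;> simpa [elems] using h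

theorem simBit_simItem (hmin : ∀ j < p, j ∈ C) (e : s.Pos ⊕ Fin (s.m * s.n))
    (a : Fin (s.l + s.κ)) :
    SimBit C 78 fun d => ((simItem d.1 d.2.1 C p d.2.2 (givenUnion C d.2.1) e).getD 0) a := by
  classical
  -- if the entry is present, it is the following value
  have key : ∀ f : SimData s → Bit, SimBit C 70 f →
      (∀ d y, simItem d.1 d.2.1 C p d.2.2 (givenUnion C d.2.1) e = some y → y a = f d) →
      SimBit C 78 fun d =>
        ((simItem d.1 d.2.1 C p d.2.2 (givenUnion C d.2.1) e).getD 0) a := by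
    intro f hf h
    refine (BitComp.ite (simProp_simItem hmin e) hf (BitComp.zero.mono (by norm_num))).congr
      fun d => ?_
    cases hd : simItem d.1 d.2.1 C p d.2.2 (givenUnion C d.2.1) e with
    | none => simp
    | some y => simp [h d y hd]
  rcases e with ⟨j, b⟩ | r
  · by_cases hp : j.1 < p
    · refine key _ ((simBit_sharedValue (fun i hi => hmin i (hi.trans_lt hp)) b a).mono
        (by norm_num)) fun d y hy => ?_
      rw [simItem, if_pos (Or.inl hp)] at hy
      cases hy
      rfl
    · refine key _ ((simBit_rot_pad j.1 b a).mono (by norm_num)) fun d y hy => ?_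
      rw [simItem] at hy
      split_ifs at hy with h
      cases hy
      rw [sharedValue_none (h.resolve_left hp).2]
  · refine key _ ((simBit_encodeElem (simBit_slot r) a).mono (by norm_num)) fun d y hy => ?_
    rw [simItem] at hy
    split_ifs at hy with h
    cases hy
    rfl

theorem length_items_le :
    (Finset.univ : Finset (s.Pos ⊕ Fin (s.m * s.n))).toList.length + 1 ≤ s.total ^ 4 := by
  have h1 := s.card_pos_le
  have h2 : s.m * s.n ≤ s.total ^ 2 := by
    rw [pow_two]
    exact Nat.mul_le_mul s.m_le s.n_le
  have h3 := s.one_le_pow 2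
  have h4 : 3 * s.total ^ 2 ≤ s.total ^ 4 := s.mul_pow_le (j := 2) (by norm_num)
  rw [Finset.length_toList, Finset.card_univ, Fintype.card_sum, Fintype.card_fin]
  omega

theorem simBit_simVec (hmin : ∀ j < p, j ∈ C) (q : s.Pos) (a : Fin (s.l + s.κ)) :
    SimBit C 104 fun d => simVec d.1 d.2.1 C p d.2.2 (givenUnion C d.2.1) q a := by
  have hs := propComp_getElem_isSome (w := s.l + s.κ) s.block_lt s.card_pos_le
    (Finset.univ : Finset (s.Pos ⊕ Fin (s.m * s.n))).toList length_items_le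
    (fun e _ => (simProp_simItem hmin e).mono (b := 78) (by norm_num))
    (fun e _ => simBit_simItem hmin e) (Fintype.equivFin s.Pos q)
  have hv := bitComp_getElem_getD (w := s.l + s.κ) s.block_lt s.card_pos_le
    (Finset.univ : Finset (s.Pos ⊕ Fin (s.m * s.n))).toList length_items_le
    (fun e _ => (simProp_simItem hmin e).mono (b := 78) (by norm_num))
    (fun e _ => simBit_simItem hmin e) (Fintype.equivFin s.Pos q) a
  refine (BitComp.ite hs hv ((simBit_delta p q.1 q.1 q.2 a).mono (Nat.zero_le _))).congr fun d => ?_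
  rw [simVec, simList]
  split_ifs with h
  · obtain ⟨y, hy⟩ := Option.isSome_iff_exists.1 h
    rw [hy]
    rfl
  · rw [Option.not_isSome_iff_eq_none.1 h]
    rfl

theorem simBit_simShare (hmin : ∀ j < p, j ∈ C) (k : s.Party) (q : s.Pos) (a : Fin (s.l + s.κ)) :
    SimBit C 121 fun d => simShare d.2.2
      (simVec d.1 d.2.1 C p d.2.2 (givenUnion C d.2.1)) k q a := by
  by_cases hk : k = 0
  · have h1 : SimBit C 118 fun d => simVec d.1 d.2.1 C p d.2.2 (givenUnion C d.2.1)
        (d.2.2.perm q) a :=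
      (BitComp.sum (a := 2) (k := 112) Finset.univ (fun r _ => BitComp.ite
        ((simProp_perm q r).mono (by norm_num)) (simBit_simVec hmin r a)
        (BitComp.zero.mono (by norm_num))) (by simpa using s.card_pos_le)).congr fun d => by simp
    have h2 : SimBit C 5 fun d => ∑ k ∈ Finset.univ.erase 0, d.2.2.share k q a :=
      BitComp.sum (a := 1) _ (fun k _ => simBit_share k q a) (card_filter_party_le _)
    refine (h1.add (h2.mono (by norm_num))).congr fun d => ?_
    rw [simShare, if_pos hk, Pi.add_apply, Finset.sum_apply]
  · exact ((simBit_share k q a).mono (by norm_num)).congr fun d => by rw [simShare, if_neg hk]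

theorem simBit_simPmt {c : s.Party} (hc : c ∈ C) (k : s.Party) (b : s.Bin) :
    SimBit C 47 fun d => simPmt d.1 d.2.1 C d.2.2 c k b := by
  rcases lt_trichotomy c k with h | rfl | h
  · exact ((simBit_pmt c k b).mono (by norm_num)).congr fun d => by rw [simPmt, if_pos h]
  · exact (BitComp.zero.mono (by norm_num)).congr fun d => by simp [simPmt]
  · have h1 : SimProp C 36 fun d => k ∈ C ∧ Member d.1 d.2.1 d.2.2 k c b := by
      by_cases hk : k ∈ C
      · exact (simProp_member hk hc b).congr fun d => and_iff_right hk
      · exact ((PropComp.const False).mono (by norm_num)).congr fun d => by simp [hk]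
    refine (((simBit_pmt k c b).mono (Nat.zero_le 36)).add h1).mono (b := 47) (by norm_num) |>.congr
      fun d => ?_
    rw [simPmt, if_neg h.not_gt, if_pos h]
    congr

theorem simBit_simRot {c : s.Party} (j i : s.Party) (b : s.Bin) (a : Fin (s.l + s.κ)) :
    SimBit C 47 fun d => simRot d.1 d.2.1 C d.2.2 c j i b a := by
  classical
  by_cases hij : i < j
  swap
  · exact (BitComp.zero.mono (by norm_num)).congr fun d => by rw [simRot, if_neg hij]; rfl
  by_cases hcf : c = min 1 i
  · have h1 : SimProp C 36 fun d => Finset.Icc (min 1 i) j ⊆ C ∧ Member d.1 d.2.1 d.2.2 i j b := by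
      by_cases hQ : Finset.Icc (min 1 i) j ⊆ C
      · have hi := hQ (Finset.mem_Icc.2 ⟨min_le_right 1 i, hij.le⟩)
        have hj := hQ (Finset.mem_Icc.2 ⟨(min_le_right 1 i).trans hij.le, le_rfl⟩)
        exact (simProp_member hi hj b).congr fun d => and_iff_right hQ
      · exact ((PropComp.const False).mono (by norm_num)).congr fun d => by simp [hQ]
    have h2 : SimBit C 5 fun d =>
        ∑ e ∈ (Finset.Icc (min 1 i) j).erase (min 1 i), d.2.2.rot j i b e a :=
      BitComp.sum (a := 1) _ (fun e _ => simBit_rot j i b e a) (card_filter_party_le _)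
    have h3 := (h2.mono (b := 44) (by norm_num)).add (BitComp.ite h1
      ((simBit_maskSum j i b a).mono (by norm_num)) (BitComp.zero.mono (by norm_num)))
    refine h3.congr fun d => ?_
    rw [simRot, if_pos hij, if_pos hcf, Pi.add_apply, Finset.sum_apply]
    congr 1
    split_ifs <;> rfl
  · by_cases hcQ : c ∈ Finset.Icc (min 1 i) j
    · exact ((simBit_rot j i b c a).mono (by norm_num)).congr fun d => by
        rw [simRot, if_pos hij, if_neg hcf, if_pos hcQ]
    · exact (BitComp.zero.mono (by norm_num)).congr fun d => by
        rw [simRot, if_pos hij, if_neg hcf, if_neg hcQ]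
        rfl

theorem simBit_viewWith (hmin : ∀ j < p, j ∈ C) {c : s.Party} (hc : c ∈ C) (v : ViewWire s) :
    SimBit C 121 fun d => viewWith d.1 d.2.1 C d.2.2
      (simVec d.1 d.2.1 C p d.2.2 (givenUnion C d.2.1)) c v := by
  cases v with
  | input t a => exact (simBit_input hc t a).mono (by norm_num)
  | cuckoo a => exact (simBit_cuckoo c a).mono (by norm_num)
  | delta j i b a => exact (simBit_delta c j i b a).mono (by norm_num)
  | pad b a => exact (simBit_pad c b a).mono (by norm_num)
  | pmt k b => exact (simBit_simPmt hc k b).mono (by norm_num)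
  | rot j i b a => exact (simBit_simRot j i b a).mono (by norm_num)
  | shuffled q a => exact simBit_simShare hmin c q a
  | message k q a =>
    by_cases h : c = 0
    · exact (simBit_simShare hmin k q a).congr fun d => if_pos h
    · exact (BitComp.zero.mono (by norm_num)).congr fun d => if_neg h

end SimCircuit

/-- The names of the bits of a view, as a finite type. -/
abbrev ViewIndex (s : Sizes) [NeZero s.m] : Type :=
  (Fin s.n × Fin s.l) ⊕ Fin s.ρ ⊕ (s.Party × s.Party × s.Bin × Fin (s.l + s.κ)) ⊕
    (s.Bin × Fin (s.l + s.κ)) ⊕ (s.Party × s.Bin) ⊕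
    (s.Party × s.Party × s.Bin × Fin (s.l + s.κ)) ⊕ (s.Pos × Fin (s.l + s.κ)) ⊕
    (s.Party × s.Pos × Fin (s.l + s.κ))

/-- The wire with a given index. -/
def ViewIndex.toWire {s : Sizes} [NeZero s.m] : ViewIndex s → ViewWire s
  | .inl x => .input x.1 x.2
  | .inr (.inl x) => .cuckoo x
  | .inr (.inr (.inl x)) => .delta x.1 x.2.1 x.2.2.1 x.2.2.2
  | .inr (.inr (.inr (.inl x))) => .pad x.1 x.2
  | .inr (.inr (.inr (.inr (.inl x)))) => .pmt x.1 x.2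
  | .inr (.inr (.inr (.inr (.inr (.inl x))))) => .rot x.1 x.2.1 x.2.2.1 x.2.2.2
  | .inr (.inr (.inr (.inr (.inr (.inr (.inl x)))))) => .shuffled x.1 x.2
  | .inr (.inr (.inr (.inr (.inr (.inr (.inr x)))))) => .message x.1 x.2.1 x.2.2

theorem ViewIndex.toWire_surjective {s : Sizes} [NeZero s.m] :
    Function.Surjective (ViewIndex.toWire (s := s)) := by
  intro v
  cases v with
  | input t a => exact ⟨.inl (t, a), rfl⟩
  | cuckoo a => exact ⟨.inr (.inl a), rfl⟩
  | delta j i b a => exact ⟨.inr (.inr (.inl (j, i, b, a))), rfl⟩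
  | pad b a => exact ⟨.inr (.inr (.inr (.inl (b, a)))), rfl⟩
  | pmt k b => exact ⟨.inr (.inr (.inr (.inr (.inl (k, b))))), rfl⟩
  | rot j i b a => exact ⟨.inr (.inr (.inr (.inr (.inr (.inl (j, i, b, a)))))), rfl⟩
  | shuffled q a => exact ⟨.inr (.inr (.inr (.inr (.inr (.inr (.inl (q, a))))))), rfl⟩
  | message k q a => exact ⟨.inr (.inr (.inr (.inr (.inr (.inr (.inr (k, q, a))))))), rfl⟩

theorem card_viewIndex_le (s : Sizes) [NeZero s.m] : Fintype.card (ViewIndex s) ≤ s.total ^ 7 := by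
  have hw := s.block_lt.le
  have hP := s.card_pos_le
  have e1 : s.n * s.l ≤ s.total ^ 4 :=
    (Nat.mul_le_mul s.n_le s.l_le).trans (by rw [← pow_two]; exact s.pow_le (by norm_num))
  have e2 : s.ρ ≤ s.total ^ 4 := s.ρ_le.trans (by simpa using s.pow_le (show 1 ≤ 4 by norm_num))
  have e3 : s.m * (s.m * (s.B * (s.l + s.κ))) ≤ s.total ^ 4 := by
    rw [show s.total ^ 4 = s.total * (s.total * (s.total * s.total)) by ring]
    gcongr <;> first | exact s.m_le | exact s.B_le
  have e4 : s.B * (s.l + s.κ) ≤ s.total ^ 4 :=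
    (Nat.mul_le_mul s.B_le hw).trans (by rw [← pow_two]; exact s.pow_le (by norm_num))
  have e5 : s.m * s.B ≤ s.total ^ 4 :=
    (Nat.mul_le_mul s.m_le s.B_le).trans (by rw [← pow_two]; exact s.pow_le (by norm_num))
  have e6 : Fintype.card s.Pos * (s.l + s.κ) ≤ s.total ^ 4 :=
    (Nat.mul_le_mul hP hw).trans (by rw [← pow_succ]; exact s.pow_le (by norm_num))
  have e7 : s.m * (Fintype.card s.Pos * (s.l + s.κ)) ≤ s.total ^ 4 := by
    rw [show s.total ^ 4 = s.total * (s.total ^ 2 * s.total) by ring]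
    gcongr
    exact s.m_le
  have hc : Fintype.card (ViewIndex s) = s.n * s.l + (s.ρ +
      (s.m * (s.m * (s.B * (s.l + s.κ))) + (s.B * (s.l + s.κ) + (s.m * s.B +
      (s.m * (s.m * (s.B * (s.l + s.κ))) + (Fintype.card s.Pos * (s.l + s.κ) +
        s.m * (Fintype.card s.Pos * (s.l + s.κ)))))))) := by
    rw [Fintype.card_sum, Fintype.card_sum, Fintype.card_sum, Fintype.card_sum, Fintype.card_sum,
      Fintype.card_sum, Fintype.card_sum]
    simp only [Fintype.card_prod, Fintype.card_fin]
  have h : 8 * s.total ^ 4 ≤ s.total ^ 7 := s.mul_pow_le (j := 3) (by norm_num)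
  rw [hc]
  omega

/-- Sampling of data that consist of bits and a permutation. -/
theorem samples_of_equiv {s : Sizes} [NeZero s.m] {Ω R α : Type} [Fintype Ω] [Nonempty Ω]
    [Fintype R] [DecidableEq R] [Fintype α] [DecidableEq α] {b : ℕ}
    (e : Ω ≃ (R → Bit) × Equiv.Perm α) (h : Fintype.card α ≤ s.total ^ b) :
    Samples s (2 * Fintype.card R + s.total ^ (4 * b + 21))
      fun ω => Sum.elim (e ω).1 (permBits (e ω).2) :=
  ((Samples.bits R).prod (samples_permBits α h)).equiv e

/-- There is a polynomial-size simulator that outputs the simulated view for uniform coins. -/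
theorem exists_simulator {s : Sizes} [NeZero s.m] {C : Finset s.Party} {p : s.Party}
    (hmin : ∀ j < p, j ∈ C) :
    ∃ S : Simulator s C, S.size ≤ s.total ^ 130 ∧ ∀ pp X,
      S.eval pp (simInput (fun c : C => X c) (if 0 ∈ C then unionOf X else ∅)) =
        (PMF.uniformOfFintype (Coins s)).map fun ω cw => viewWith pp X C ω
          (simVec pp X C p ω (if 0 ∈ C then unionOf X else ∅)) cw.1 cw.2 := by
  classical
  obtain ⟨R, hR, hR'⟩ := samples_of_equiv (coinsEquiv s) s.card_pos_le
  have hfam : Realizes (Prod.fst : SimData s → PublicFunctions s) (simEnv C)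
      (s.total ^ (8 + 121)) fun d (cv : C × ViewIndex s) => viewWith d.1 d.2.1 C d.2.2
        (simVec d.1 d.2.1 C p d.2.2 (givenUnion C d.2.1)) cv.1 cv.2.toWire := by
    refine BitComp.family (fun cv => simBit_viewWith hmin cv.1.2 _) ?_
    rw [Fintype.card_prod, Fintype.card_coe, show s.total ^ 8 = s.total * s.total ^ 7 by ring]
    exact Nat.mul_le_mul ((Finset.card_le_univ C).trans (by simpa using s.m_le))
      (card_viewIndex_le s)
  obtain ⟨D, hD, hD'⟩ := hfam.rewire fun cw : C × ViewWire s =>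
    (cw.1, Function.surjInv ViewIndex.toWire_surjective cw.2)
  refine ⟨.comp (.wire (Sum.elim Empty.elim id : Empty ⊕ SimWire s C → _))
    (.comp (.par R (.wire id)) D), ?_, fun pp X => ?_⟩
  · simp only [Circuit.size]
    have h1 := card_coinWire_le s
    have h2 : 2 * s.total ^ 129 ≤ s.total ^ 130 := s.mul_pow_le (j := 1) (by norm_num)
    have h3 : s.total ^ 29 ≤ s.total ^ 127 := s.pow_le (by norm_num)
    have h4 : s.total ^ 8 ≤ s.total ^ 127 := s.pow_le (by norm_num)
    have h5 : 3 * s.total ^ 127 ≤ s.total ^ 129 := s.mul_pow_le (j := 2) (by norm_num)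
    have hR : R.size ≤ 2 * Fintype.card (CoinWire s) + s.total ^ 29 := hR
    have hD : D.size ≤ s.total ^ 129 := hD
    omega
  · have hU : (if 0 ∈ C then unionOf X else ∅) = givenUnion C X := rfl
    have h1 : ∀ x : SimWire s C → Bit,
        (x ∘ (Sum.elim Empty.elim id : Empty ⊕ SimWire s C → _)) ∘ Sum.inr = x := fun _ => rfl
    rw [hU]
    simp only [Circuit.eval, PMF.pure_bind, hR', h1, Function.comp_id, PMF.pure_map, PMF.bind_bind,
      PMF.bind_map]
    rw [PMF.map]
    congr 1
    funext ω
    have h2 := hD' (pp, X, ω)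
    simp only [Function.comp_def, Function.surjInv_eq] at h2
    simp only [Function.comp, PMF.pure_bind]
    exact h2

theorem theorem3 :
    ∃ a d : ℕ, ∀ (s : Sizes) [NeZero s.m] (C : Finset s.Party), C.card < s.m →
      ∃ S : Simulator s C, S.size ≤ a * s.total ^ d ∧
        ∀ (pp : PublicFunctions s) (X : s.Party → s.Input), (∀ j, Function.Injective (X j)) →
          StatClose (((s.m - 1 : ℝ) * s.B) / 2 ^ s.κ + cuckooFailure pp X)
            (realExec pp C X) (idealExec pp S X) := by
  refine ⟨1, 130, fun s _ C hC => ?_⟩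
  have hne : ∃ p, p ∉ C := by
    by_contra h
    push Not at h
    rw [Finset.eq_univ_iff_forall.2 h] at hC
    simp at hC
  obtain ⟨p, hp, hmin⟩ : ∃ p, p ∉ C ∧ ∀ j < p, j ∈ C := by
    obtain ⟨p, hp, hmin⟩ := WellFounded.has_min (wellFounded_lt (α := s.Party)) {p | p ∉ C} hne
    exact ⟨p, hp, fun j hj => by_contra fun h => hmin j h hj⟩
  obtain ⟨S, hS, hS'⟩ := exists_simulator hmin
  exact ⟨S, by simpa using hS, fun pp X hX =>
    statClose_of_eval_eq hp hmin pp X hX S (hS' pp X)⟩
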